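/- Let $q>p>1$, let $p^*=p/(p-1)$, and consider on $(0,\infty)$ the measures $\mu(dx)=x^{-q/p^*-1}\,dx$ and $\nu(dx)=dx$. Let $$A=\sup\Big\{\frac{\|f\|_{L^q(\mu)}}{\|f'\|_{L^p(\nu)}}\Big\},$$ the supremum being over all $f$ on $[0,\infty)$ that are absolutely continuous on every $[0,b]$, with $f(0)=0$ and $0<\|f'\|_{L^p(\nu)}<\infty$. Put $$k_{q,p}=\left[\frac{\Gamma\big(\frac{pq}{q-p}\big)}{\Gamma\big(\frac{q}{q-p}\big)\Gamma\big(\frac{p(q-1)}{q-p}\big)}\right]^{1/p-1/q},\qquad \tilde k_{q,p}=\Big(1+\frac q{p^*}\Big)^{1/q}\Big(1+\frac{p^*}q\Big)^{1/p^*}.$$ Let $v$ be the density of $\nu$ with respect to Lebesgue measure, $\hat v=v^{1-p^*}$, $\varphi(x)=\int_0^x\hat v(y)\,dy$ (so here $v=\hat v=1$ and $\varphi(x)=x$), and $B=\sup_{x>0}\varphi(x)^{1/p^*}\mu(x,\infty)^{1/q}$. Define $f_1=\varphi^{\gamma^*}$ with $\gamma^*=\frac q{p^*+q}$ and, for $n\ge1$,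 $$f_{n+1}(x)=\int_0^x\hat v(y)\Big(\int_y^\infty f_n^{q/p^*}d\mu\Big)^{p^*/q}dy,\qquad \delta_n=\Big(\sup_{x>0}\frac{f_{n+1}(x)}{f_n(x)}\Big)^{1/p^*},$$ with the convention that $\delta_n=\infty$ for $n\ge 2$ if $\delta_1=\infty$. Finally let $$\bar\delta_1=\sup_{x_0\in(0,\infty]}\frac{\|\varphi(\cdot\wedge x_0)\|_{L^q(\mu)}}{\|\varphi(\cdot\wedge x_0)'\|_{L^p(\nu)}},$$ where those $x_0$ for which the quotient is $\infty/\infty$ (here only $x_0=\infty$) are disregarded. Then the following hold. 1. $A$ is the least constant $C\in[0,\infty]$ such that $\|f\|_{L^q(\mu)}\le C\,\|f'\|_{L^p(\nu)}$ for all $f$ on $[0,\infty)$ that are absolutely continuous on every $[0,b]$ and satisfy $f(0)=0$. Moreover $$A=\Big(\frac{p^*}q\Big)^{1/q}k_{q,p},\qquad B=\Big(\frac{p^*}q\Big)^{1/q},\qquad A=k_{q,p}B.$$ 2. The constant $A$ is attained: let $\gamma=\frac qp-1$. For all $\alpha,\beta>0$ the function $g(x)=\dfrac{\alpha x}{(1+\beta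 x^\gamma)^{1/\gamma}}$ is absolutely continuous on every $[0,b]$, $g(0)=0$, $g'(x)=\dfrac{\alpha}{(\beta x^\gamma+1)^{(\gamma+1)/\gamma}}$ for $x>0$, $0<\|g'\|_{L^p(\nu)}<\infty$, and $\|g\|_{L^q(\mu)}=A\,\|g'\|_{L^p(\nu)}$. 3. For every $n\ge1$, $$\delta_n=\Big(1+\frac{p^*}q\Big)^{1/p^*+1/q}=\tilde k_{q,p}B>k_{q,p}B .$$ Moreover, with $\tilde p=\frac q{p^*}+1$, let $\tilde A$ be the constant defined like $A$, with the same $\mu$ and $\nu$, but with both exponents $p$ and $q$ replaced by $\tilde p$. Then $\tilde A=\frac{p^*}q+1$ and $\delta_n=\tilde A^{\,1/p^*+1/q}$ for every $n\ge1$. 4. $$\bar\delta_1=\Big(\frac{pp^*}q\Big)^{1/q}=p^{1/q}B,\qquad B<\bar\delta_1<A .$$ -/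

import Mathlib

open MeasureTheory Set
open scoped ENNReal

noncomputable section

/-- Functions on `[0, ∞)` that vanish at `0` and are absolutely continuous on every `[0, b]`.
The values on `(-∞, 0)` play no role, because the measures used below are carried by `(0, ∞)`. -/
def HardyAC0 : Set (ℝ → ℝ) :=
  {f | f 0 = 0 ∧ ∀ b : ℝ, 0 ≤ b → AbsolutelyContinuousOnInterval f 0 b}

/-- The Hardy-type inequality `‖f‖_{L^q(μ)} ≤ C ‖f'‖_{L^p(ν)}` for all absolutely continuous `f`
with `f(0) = 0`. -/
def HardyIneq (p q : ℝ) (μ ν : Measure ℝ) (C : ℝ≥0∞) : Prop :=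
  ∀ f ∈ HardyAC0,
    eLpNorm f (ENNReal.ofReal q) μ ≤ C * eLpNorm (deriv f) (ENNReal.ofReal p) ν

/-- The optimal constant `A`: the supremum of `‖f‖_{L^q(μ)} / ‖f'‖_{L^p(ν)}` over all absolutely
continuous `f` with `f(0) = 0` and `0 < ‖f'‖_{L^p(ν)} < ∞`. -/
def hardyConst (p q : ℝ) (μ ν : Measure ℝ) : ℝ≥0∞ :=
  ⨆ f ∈ {f : ℝ → ℝ | f ∈ HardyAC0 ∧ 0 < eLpNorm (deriv f) (ENNReal.ofReal p) ν ∧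
      eLpNorm (deriv f) (ENNReal.ofReal p) ν < ∞},
    eLpNorm f (ENNReal.ofReal q) μ / eLpNorm (deriv f) (ENNReal.ofReal p) ν

/-- `v̂ = v ^ (1 - p*)`, where `v` is the Lebesgue density of the absolutely continuous part
of `ν`. -/
def hardyHat (p : ℝ) (ν : Measure ℝ) (y : ℝ) : ℝ≥0∞ :=
  ν.rnDeriv volume y ^ (1 - p.conjExponent)

/-- `φ(x) = ν̂(0, x) = ∫₀ˣ v̂`. -/
def hardyPhi (p : ℝ) (ν : Measure ℝ) (x : ℝ) : ℝ≥0∞ :=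
  ∫⁻ y in Ioo 0 x, hardyHat p ν y

/-- `B = sup_{x > 0} ν̂(0, x) ^ (1/p*) μ(x, ∞) ^ (1/q)`. -/
def hardyB (p q : ℝ) (μ ν : Measure ℝ) : ℝ≥0∞ :=
  ⨆ x ∈ Ioi (0 : ℝ), hardyPhi p ν x ^ (1 / p.conjExponent) * μ (Ioi x) ^ (1 / q)

/-- The sharp factor `k_{q,p}` (for `q > p`). -/
def sharpFactor (p q : ℝ) : ℝ :=
  (Real.Gamma (p * q / (q - p)) /
    (Real.Gamma (q / (q - p)) * Real.Gamma (p * (q - 1) / (q - p)))) ^ (1 / p - 1 / q)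

/-- The factor `k̃_{q,p} = (1 + q/p*) ^ (1/q) (1 + p*/q) ^ (1/p*)`. -/
def roughFactor (p q : ℝ) : ℝ :=
  (1 + q / p.conjExponent) ^ (1 / q) * (1 + p.conjExponent / q) ^ (1 / p.conjExponent)

/-- The test functions of the upper approximating procedure, numbered from `1` (the value at index
`0` is not used): `f₁ = ν̂(0, x) ^ γ*` with `γ* = q / (p* + q)`, and
`f_{n+1}(x) = ∫₀ˣ v̂(y) (∫_y^∞ f_n ^ (q/p*) dμ) ^ (p*/q) dy`. -/
def upperSeq (p q : ℝ) (μ ν : Measure ℝ) : ℕ → ℝ → ℝ≥0∞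
  | 0, x => hardyPhi p ν x ^ (q / (p.conjExponent + q))
  | 1, x => hardyPhi p ν x ^ (q / (p.conjExponent + q))
  | n + 2, x => ∫⁻ y in Ioo 0 x, hardyHat p ν y *
      (∫⁻ z in Ioi y, upperSeq p q μ ν (n + 1) z ^ (q / p.conjExponent) ∂μ)
        ^ (p.conjExponent / q)

/-- `(sup_{x > 0} f_{n+1}(x) / f_n(x)) ^ (1/p*)`. -/
def upperRatio (p q : ℝ) (μ ν : Measure ℝ) (n : ℕ) : ℝ≥0∞ :=
  (⨆ x ∈ Ioi (0 : ℝ), upperSeq p q μ ν (n + 1) x / upperSeq p q μ ν n x)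
    ^ (1 / p.conjExponent)

/-- The upper bounds `δ_n`, `n ≥ 1`: the ratio above, except that `δ_n = ∞` if `n ≥ 2` and
`δ_1 = ∞`. -/
def upperDelta (p q : ℝ) (μ ν : Measure ℝ) (n : ℕ) : ℝ≥0∞ :=
  if n = 1 ∨ upperRatio p q μ ν 1 < ∞ then upperRatio p q μ ν n else ∞

/-- `f₁^{(x₀)}(x) = ν̂(0, x ∧ x₀)` for `x ≥ 0` and `x₀ ∈ (0, ∞]`. -/
def lowerTest (p : ℝ) (ν : Measure ℝ) (x₀ : ℝ≥0∞) (x : ℝ) : ℝ :=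
  (hardyPhi p ν (min (ENNReal.ofReal x) x₀).toReal).toReal

/-- The lower bound `δ̄₁ = sup_{x₀ ∈ (0, ∞]} ‖f₁^{(x₀)}‖_{L^q(μ)} / ‖(f₁^{(x₀)})'‖_{L^p(ν)}`.
An indeterminate quotient `∞ / ∞` or `0 / 0` has the value `0` in `ℝ≥0∞`, that is, such an `x₀`
does not contribute. -/
def lowerDelta1 (p q : ℝ) (μ ν : Measure ℝ) : ℝ≥0∞ :=
  ⨆ x₀ ∈ Ioi (0 : ℝ≥0∞),
    eLpNorm (lowerTest p ν x₀) (ENNReal.ofReal q) μ /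
      eLpNorm (deriv (lowerTest p ν x₀)) (ENNReal.ofReal p) ν

/-- Lebesgue measure on `(0, ∞)`. -/
def halfLebesgue : Measure ℝ := volume.restrict (Ioi 0)

/-- The measure `x ^ (-q/p* - 1) dx` on `(0, ∞)`. -/
def blissMeasure (p q : ℝ) : Measure ℝ :=
  halfLebesgue.withDensity fun x => ENNReal.ofReal (x ^ (-q / p.conjExponent - 1))

/-- `α x / (1 + β x^γ) ^ (1/γ)` with `γ = q/p - 1`. -/
def blissFun (p q α β : ℝ) (x : ℝ) : ℝ :=
  α * x / (1 + β * x ^ (q / p - 1)) ^ (1 / (q / p - 1))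

end

/-! The core is Bliss's inequality, obtained by transport of mass. With `P` the conjugate exponent
of `p`, put `m = q/P + 1`, `g = q/p - 1`, `n = pq/(q-p)`, so that `m + g = n g = q`. The function `x
/ (1 + x^g)^(1/g)` has mass density `k(s) = s^g (1 + s^g)^(-n)`. For `f = ∫ H` with `H` continuous
and positive, let `M` be the primitive of `f^q x^(-m)` and let `T` be the map that carries `f^q
x^(-m) dx` to `k(s) ds`; for the function above, `T` is the identity.

The potential `(m/p) M + (1/n) T (1 + T^g)^(1-n) + (P/q) f^m x^(-m/P) T^(-g/P)` has derivative at
most `(P m / (q p)) H^p`. This takes one weighted arithmetic-geometric mean (`bliss_amgm`) and one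
application of Young's inequality (`bliss_young`), both equalities in the extremal case. The
potential tends to `0` at `0` and dominates `(m/p) M`, so the mass is at most `P/q` times the
energy, provided that it is below `J = ∫ k` (`bliss_of_mass_lt`). Scaling `f` until its mass reaches
`J` gives the homogeneous inequality (`bliss_interval`); density in `L^p` and Fatou's lemma extend
it to all admissible functions (`hardyIneq_of_continuous`). Gamma integrals evaluate `J` and both
norms of the extremal functions, which yields the value of the constant and its attainment.

The upper procedure is stationary: a power of `x` is an eigenfunction of its step, so all `δ_n`
coincide, and their value is a power of the constant in the classical Hardy inequality, whose
sharpness comes from truncated powers. The lower bound is an explicit integral.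

The strict comparisons concern `Γ(s+1) Γ(t+1) / Γ(s+t+1)` with `s = p/(q-p)`, `t = q(p-1)/(q-p)`: it
lies above `x₀^s (1-x₀)^t` for every `x₀` in `(0, 1)` (`lt_Gamma_quotient`) and below
`((s+1)/(s+t+1))^s` (`Gamma_quotient_lt`). -/

/-! ### The transport map and its potential -/

/-- A primitive of a continuous function that is positive on `(0, ∞)` has a differentiable inverse
there. -/
theorem exists_inverse_primitive {k : ℝ → ℝ} (hk : Continuous k) (hpos : ∀ s, 0 < s → 0 < k s) :
    ∃ S : ℝ → ℝ, ∀ y, 0 < y → (∃ X, 0 < X ∧ y < ∫ t in (0 : ℝ)..X, k t) →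
      0 < S y ∧ (∫ t in (0 : ℝ)..S y, k t) = y ∧ HasDerivAt S (k (S y))⁻¹ y := by
  set N : ℝ → ℝ := fun s => ∫ t in (0 : ℝ)..s, k t with hN
  have hder : ∀ s, HasDerivAt N (k s) s := fun s => hk.integral_hasStrictDerivAt 0 s |>.hasDerivAt
  have hcont : Continuous N := continuous_iff_continuousAt.2 fun s => (hder s).continuousAt
  have hmono : StrictMonoOn N (Ici 0) :=
    strictMonoOn_of_deriv_pos (convex_Ici 0) hcont.continuousOn fun x hx => by
      rw [interior_Ici] at hx
      rw [(hder x).deriv]; exact hpos x hx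
  have h0 : N 0 = 0 := by simp [hN]
  have hex : ∀ y, 0 < y → (∃ X, 0 < X ∧ y < N X) → ∃ s, 0 < s ∧ N s = y := by
    rintro y hy ⟨X, hX, hyX⟩
    obtain ⟨s, hs, hsy⟩ := intermediate_value_Ioo hX.le hcont.continuousOn
      (show y ∈ Ioo (N 0) (N X) from ⟨by rw [h0]; exact hy, hyX⟩)
    exact ⟨s, hs.1, hsy⟩
  classical
  refine ⟨fun y => if h : ∃ s, 0 < s ∧ N s = y then h.choose else 0, ?_⟩
  set S : ℝ → ℝ := fun y => if h : ∃ s, 0 < s ∧ N s = y then h.choose else 0 with hS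
  have hS1 : ∀ y, (∃ s, 0 < s ∧ N s = y) → 0 < S y ∧ N (S y) = y := fun y h => by
    simp only [hS, dif_pos h]; exact h.choose_spec
  have hS2 : ∀ s, 0 < s → S (N s) = s := fun s hs => by
    obtain ⟨h1, h2⟩ := hS1 (N s) ⟨s, hs, rfl⟩
    exact hmono.injOn (mem_Ici.2 h1.le) (mem_Ici.2 hs.le) h2
  intro y hy hyX
  obtain ⟨h1, h2⟩ := hS1 y (hex y hy hyX)
  obtain ⟨X, hX, hyX⟩ := hyX
  have hnhds : Ioo 0 (N X) ∈ nhds y := Ioo_mem_nhds hy hyX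
  have hall : ∀ z ∈ Ioo 0 (N X), 0 < S z ∧ N (S z) = z := fun z hz => hS1 z (hex z hz.1 ⟨X, hX, hz.2⟩)
  refine ⟨h1, h2, ?_⟩
  refine HasDerivAt.of_local_left_inverse ?_ (hder (S y)) (hpos _ h1).ne' ?_
  · refine continuousAt_of_monotoneOn_of_image_mem_nhds (s := Ioo 0 (N X)) ?_ hnhds ?_
    · intro a ha b hb hab
      by_contra hlt
      push Not at hlt
      have := hmono (mem_Ici.2 (hall b hb).1.le) (mem_Ici.2 (hall a ha).1.le) hlt
      rw [(hall a ha).2, (hall b hb).2] at this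
      linarith
    · have hSX : S y < X := by
        by_contra hle
        push Not at hle
        have := hmono.monotoneOn (mem_Ici.2 hX.le) (mem_Ici.2 h1.le) hle
        rw [h2] at this; linarith
      filter_upwards [Ioo_mem_nhds h1 hSX] with s hs
      refine ⟨N s, ⟨?_, hmono (mem_Ici.2 hs.1.le) (mem_Ici.2 hX.le) hs.2⟩, hS2 s hs.1⟩
      rw [← h0]; exact hmono (mem_Ici.2 le_rfl) (mem_Ici.2 hs.1.le) hs.1
  · filter_upwards [hnhds] with z hz using (hall z hz).2

theorem Real.exists_exp_eq {x : ℝ} (hx : 0 < x) : ∃ u, x = Real.exp u :=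
  ⟨Real.log x, (Real.exp_log hx).symm⟩

/-- The weighted arithmetic-geometric mean inequality behind the transport argument. -/
theorem bliss_amgm {p q P m g n F x s : ℝ} (hp : 1 < p) (hpq : p < q) (hP : P = p / (p - 1))
    (hm : m = q / P + 1) (hg : g = q / p - 1) (hn : n = p * q / (q - p))
    (hF : 0 < F) (hx : 0 < x) (hs : 0 < s) :
    F ^ q * x ^ (-m) * (1 + s ^ (-g)) ≤
      m / q * (F ^ m * x ^ (-(m / P) - 1) * s ^ (-(g / P))) +
      g / q * (F ^ m * x ^ (-(m / P)) * s ^ (-(g / P) - 1) *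
        (F ^ q * x ^ (-m) * (s ^ g * (1 + s ^ g) ^ (-n))⁻¹)) := by
  have h1 : 0 < p - 1 := by linarith
  have h2 : 0 < q - p := by linarith
  have hp0 : 0 < p := by linarith
  have hq0 : 0 < q := by linarith
  have hm0 : 0 ≤ m / q := by rw [hm, hP]; positivity
  have hg0 : 0 ≤ g / q := by
    rw [hg, show q / p - 1 = (q - p) / p by field_simp]; positivity
  have hsum : m / q + g / q = 1 := by rw [hm, hg, hP]; field_simp; ring
  refine le_trans (le_of_eq ?_) (Real.geom_mean_le_arith_mean2_weighted hm0 hg0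
    (by positivity) (by positivity) hsum)
  have hz : 0 < 1 + s ^ g := by positivity
  have hsplit : 1 + s ^ (-g) = s ^ (-g) * (1 + s ^ g) := by
    rw [mul_add, ← Real.rpow_add hs]; simp [add_comm]
  rw [hsplit]
  -- With all positive bases written as exponentials, the identity of powers becomes an algebraic
  -- identity of exponents. The base `1 + s ^ g` is kept as an independent variable; its exponents
  -- match because `n * g = q`.
  obtain ⟨z, hz'⟩ := Real.exists_exp_eq hz
  rw [hz']
  obtain ⟨u, rfl⟩ := Real.exists_exp_eq hF
  obtain ⟨v, rfl⟩ := Real.exists_exp_eq hx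
  obtain ⟨y, rfl⟩ := Real.exists_exp_eq hs
  simp only [← Real.exp_mul, ← Real.exp_add, ← Real.exp_neg]
  congr 1
  clear hz' hz hsplit hm0 hg0 hsum
  subst hn hg hm hP
  field_simp
  ring

/-- Controls the only term of the potential's derivative that contains `h`. The second summand on
the right is cancelled by what the weighted mean inequality leaves over. -/
theorem bliss_young {p q P m g F h x s : ℝ} (hp : 1 < p) (hP : P = p / (p - 1))
    (hm : m = q / P + 1) (hg : g = q / p - 1)
    (hF : 0 < F) (hh : 0 < h) (hx : 0 < x) (hs : 0 < s) :
    h * (F ^ (m - 1) * x ^ (-(m / P)) * s ^ (-(g / P))) ≤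
      h ^ p / p + F ^ q * x ^ (-m) * s ^ (-g) / P := by
  have h1 : 0 < p - 1 := by linarith
  have hp0 : 0 < p := by linarith
  have hc : p.HolderConjugate P := by
    rw [Real.holderConjugate_iff]; refine ⟨hp, ?_⟩; rw [hP]; field_simp; ring
  refine (Real.young_inequality_of_nonneg hh.le (by positivity) hc).trans (le_of_eq ?_)
  congr 2
  obtain ⟨u, rfl⟩ := Real.exists_exp_eq hF
  obtain ⟨v, rfl⟩ := Real.exists_exp_eq hx
  obtain ⟨y, rfl⟩ := Real.exists_exp_eq hs
  simp only [← Real.exp_mul, ← Real.exp_add]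
  congr 1
  subst hg hm hP
  field_simp
  ring

/-- The derivative of the potential of the transport argument. -/
theorem bliss_potential_hasDerivAt {p q P m g n x h : ℝ} {f M S : ℝ → ℝ} (hp : 1 < p)
    (hpq : p < q) (hP : P = p / (p - 1))
    (hm : m = q / P + 1) (hg : g = q / p - 1) (hn : n = p * q / (q - p))
    (hx : 0 < x) (hh : 0 < h) (hF : 0 < f x) (hs : 0 < S x)
    (hf : HasDerivAt f h x) (hM : HasDerivAt M (f x ^ q * x ^ (-m)) x)
    (hS : HasDerivAt S (f x ^ q * x ^ (-m) * (S x ^ g * (1 + S x ^ g) ^ (-n))⁻¹) x) :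
    ∃ d, d ≤ P * m / (q * p) * h ^ p ∧
      HasDerivAt (fun y => m / p * M y + 1 / n * (S y * (1 + S y ^ g) ^ (1 - n)) +
        P / q * (f y ^ m * y ^ (-(m / P)) * S y ^ (-(g / P)))) d x := by
  have h1 : 0 < p - 1 := by linarith
  have h2 : 0 < q - p := by linarith
  have hp0 : 0 < p := by linarith
  have hq0 : 0 < q := by linarith
  have hz : 0 < 1 + S x ^ g := by positivity
  have hm0 : 0 < m := by rw [hm, hP]; positivity
  have hPpos : 0 < P := by rw [hP]; positivity
  have e1 : HasDerivAt (fun y => m / p * M y) (m / p * (f x ^ q * x ^ (-m))) x := hM.const_mul _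
  have e2 := ((hS.rpow_const (p := g) (Or.inl hs.ne')).const_add 1).rpow_const (p := 1 - n)
    (Or.inl hz.ne')
  have e3 := (hS.mul e2).const_mul (1 / n)
  have e4 := (((hf.rpow_const (p := m) (Or.inl hF.ne')).mul
    ((hasDerivAt_id x).rpow_const (p := -(m / P)) (Or.inl hx.ne'))).mul
    (hS.rpow_const (p := -(g / P)) (Or.inl hs.ne'))).const_mul (P / q)
  refine ⟨_, ?_, (e1.add e3).add e4⟩
  have A := bliss_amgm hp hpq hP hm hg hn hF hx hs
  have Y := bliss_young hp hP hm hg hF hh hx hs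
  simp only [id, Pi.mul_apply, one_mul]
  set F := f x
  set s := S x
  set W := F ^ q * x ^ (-m) with hW
  set σ := W * (s ^ g * (1 + s ^ g) ^ (-n))⁻¹ with hσ
  have r1 : s ^ (g - 1) = s ^ g / s := Real.rpow_sub_one hs.ne' g
  have r2 : (1 + s ^ g) ^ (1 - n) = (1 + s ^ g) * (1 + s ^ g) ^ (-n) := by
    rw [sub_eq_add_neg, Real.rpow_add hz, Real.rpow_one]
  have r3 : (1 + s ^ g) ^ (1 - n - 1) = (1 + s ^ g) ^ (-n) := by congr 1; ring
  have r4 : s ^ (-g) = (s ^ g)⁻¹ := Real.rpow_neg hs.le g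
  have hzn : 0 < (1 + s ^ g) ^ (-n) := by positivity
  have hsg : 0 < s ^ g := by positivity
  -- The speed `σ` of the transport map divides by the kernel, so the powers of `1 + s ^ g` cancel
  -- and only `W` and `s ^ (-g)` survive.
  have hD : σ * (1 + s ^ g) ^ (1 - n) + s * (σ * g * s ^ (g - 1) * (1 - n) * (1 + s ^ g) ^ (1 - n - 1))
      = W * (s ^ (-g) - (m - 1)) := by
    have hng : n * g = q := by rw [hn, hg]; field_simp
    have hmg : m + g = q := by rw [hm, hg, hP]; field_simp; ring
    rw [r1, r2, r3, r4, hσ]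
    field_simp
    linear_combination W * (-s ^ g) * hng + W * s ^ g * hmg
  rw [hD]
  have k1 : m / p * W + 1 / n * (W * (s ^ (-g) - (m - 1))) = W * (1 + s ^ (-g)) - m / q * (W * s ^ (-g)) := by
    rw [hn, hm, hP]; field_simp; ring
  -- The positive term is the left side of `bliss_young`; the two negative terms are exactly the
  -- right side of `bliss_amgm`.
  have k2 : P / q * ((h * m * F ^ (m - 1) * x ^ (-(m / P)) + F ^ m * (-(m / P) * x ^ (-(m / P) - 1))) * s ^ (-(g / P)) +
     F ^ m * x ^ (-(m / P)) * (σ * -(g / P) * s ^ (-(g / P) - 1))) =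
     P * m / q * (h * (F ^ (m - 1) * x ^ (-(m / P)) * s ^ (-(g / P)))) -
     (m / q * (F ^ m * x ^ (-(m / P) - 1) * s ^ (-(g / P))) +
      g / q * (F ^ m * x ^ (-(m / P)) * s ^ (-(g / P) - 1) * σ)) := by
    field_simp
    ring
  rw [k1, k2]
  have Y' := mul_le_mul_of_nonneg_left Y (show 0 ≤ P * m / q by positivity)
  have k3 : P * m / q * (h ^ p / p + W * s ^ (-g) / P) = P * m / (q * p) * h ^ p + m / q * (W * s ^ (-g)) := by
    field_simp
  rw [k3] at Y'
  linarith

/-! ### Bliss's inequality on bounded intervals -/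

/-- The primitive of a positive continuous function is comparable to the identity near `0`. -/
theorem exists_linear_bounds {H : ℝ → ℝ} (hH : Continuous H) (hpos : ∀ x, 0 < H x) {X : ℝ}
    (hX : 0 < X) : ∃ c C, 0 < c ∧ 0 < C ∧ ∀ x ∈ Icc 0 X,
      c * x ≤ (∫ t in (0 : ℝ)..x, H t) ∧ (∫ t in (0 : ℝ)..x, H t) ≤ C * x := by
  obtain ⟨a, ha, hamin⟩ := isCompact_Icc.exists_isMinOn (nonempty_Icc.2 hX.le) hH.continuousOn
  obtain ⟨b, hb, hbmax⟩ := isCompact_Icc.exists_isMaxOn (nonempty_Icc.2 hX.le) hH.continuousOn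
  refine ⟨H a, H b, hpos a, hpos b, fun x hx => ⟨?_, ?_⟩⟩
  · have := intervalIntegral.integral_mono_on hx.1 (μ := volume) (f := fun _ => H a) (g := H)
      (by simp) (hH.intervalIntegrable _ _) fun t ht => hamin ⟨ht.1, ht.2.trans hx.2⟩
    simpa [mul_comm] using this
  · have := intervalIntegral.integral_mono_on hx.1 (μ := volume) (g := fun _ => H b) (f := H)
      (hH.intervalIntegrable _ _) (by simp) fun t ht => hbmax ⟨ht.1, ht.2.trans hx.2⟩
    simpa [mul_comm] using this

theorem continuous_primitive {H : ℝ → ℝ} (hH : Continuous H) :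
    Continuous fun x => ∫ t in (0 : ℝ)..x, H t :=
  continuous_iff_continuousAt.2 fun s =>
    (hH.integral_hasStrictDerivAt 0 s).hasDerivAt.continuousAt

theorem primitive_pos {H : ℝ → ℝ} (hH : Continuous H) (hpos : ∀ x, 0 < H x) {x : ℝ} (hx : 0 < x) :
    0 < ∫ t in (0 : ℝ)..x, H t :=
  intervalIntegral.intervalIntegral_pos_of_pos (hH.intervalIntegrable _ _) hpos hx

/-- Bounds, integrability and regularity of `∫₀ˣ f ^ q t ^ (-m) dt` for `f` comparable to the
identity near `0`. -/
theorem weighted_primitive_bounds {q m g c C X : ℝ} {f : ℝ → ℝ} (hf : Continuous f)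
    (hq : 0 < q) (hmg : m + g = q) (hg : 0 ≤ g) (hX : 0 < X) (hc : 0 < c) (hC : 0 < C)
    (hb : ∀ x ∈ Icc 0 X, c * x ≤ f x ∧ f x ≤ C * x) :
    IntervalIntegrable (fun t => f t ^ q * t ^ (-m)) volume 0 X ∧
    ∀ x ∈ Ioc 0 X, c ^ q * (x ^ (g + 1) / (g + 1)) ≤ (∫ t in (0 : ℝ)..x, f t ^ q * t ^ (-m)) ∧
      (∫ t in (0 : ℝ)..x, f t ^ q * t ^ (-m)) ≤ C ^ q * (x ^ (g + 1) / (g + 1)) := by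
  have hpw : ∀ t ∈ Ioc 0 X, c ^ q * t ^ g ≤ f t ^ q * t ^ (-m) ∧
      f t ^ q * t ^ (-m) ≤ C ^ q * t ^ g := by
    intro t ht
    have ht0 : 0 < t := ht.1
    have e : ∀ d : ℝ, 0 < d → (d * t) ^ q * t ^ (-m) = d ^ q * t ^ g := by
      intro d hd
      rw [Real.mul_rpow hd.le ht0.le, mul_assoc, ← Real.rpow_add ht0]
      congr 2; linarith
    have hb' := hb t ⟨ht0.le, ht.2⟩
    have h0 : 0 < c * t := by positivity
    rw [← e c hc, ← e C hC]
    constructor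
    · gcongr; exact hb'.1
    · gcongr
      · linarith
      · exact hb'.2
  have hmeas : Measurable (fun t => f t ^ q * t ^ (-m)) :=
    (hf.measurable.pow_const q).mul (measurable_id.pow_const _)
  have hrp : ∀ d x : ℝ, IntervalIntegrable (fun t : ℝ => d * t ^ g) volume 0 x := fun d x =>
    (intervalIntegral.intervalIntegrable_rpow (Or.inl hg)).const_mul d
  have hint : ∀ x ∈ Ioc 0 X, IntervalIntegrable (fun t => f t ^ q * t ^ (-m)) volume 0 x := by
    intro x hx
    refine (hrp (C ^ q) x).mono_fun hmeas.aestronglyMeasurable ?_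
    rw [Filter.EventuallyLE, ae_restrict_iff' measurableSet_uIoc]
    refine Filter.Eventually.of_forall fun t ht => ?_
    rw [uIoc_of_le hx.1.le] at ht
    have := hpw t ⟨ht.1, ht.2.trans hx.2⟩
    have ht0 : 0 < t := ht.1
    have : 0 ≤ c ^ q * t ^ g := by positivity
    rw [Real.norm_of_nonneg (by linarith), Real.norm_of_nonneg (by positivity)]
    linarith
  have hval : ∀ d x : ℝ, (∫ t in (0 : ℝ)..x, d * t ^ g) = d * (x ^ (g + 1) / (g + 1)) := by
    intro d x
    rw [intervalIntegral.integral_const_mul, integral_rpow (Or.inl (by linarith)),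
      Real.zero_rpow (by linarith), sub_zero]
  refine ⟨hint X ⟨hX, le_rfl⟩, fun x hx => ?_⟩
  rw [← hval, ← hval]
  constructor
  · refine intervalIntegral.integral_mono_on_of_le_Ioo hx.1.le (hrp _ _) (hint x hx) fun t ht => ?_
    exact (hpw t ⟨ht.1, ht.2.le.trans hx.2⟩).1
  · refine intervalIntegral.integral_mono_on_of_le_Ioo hx.1.le (hint x hx) (hrp _ _) fun t ht => ?_
    exact (hpw t ⟨ht.1, ht.2.le.trans hx.2⟩).2

/-- The mass density `t ^ g (1 + t ^ g) ^ (-n)` of the extremal function, extended evenly. -/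
noncomputable def blissKernel (g n t : ℝ) : ℝ := |t| ^ g * (1 + |t| ^ g) ^ (-n)

theorem continuous_blissKernel {g : ℝ} (n : ℝ) (hg : 0 < g) : Continuous (blissKernel g n) := by
  have h : Continuous fun t : ℝ => |t| ^ g := continuous_abs.rpow_const fun _ => Or.inr hg.le
  have h1 : Continuous fun t : ℝ => 1 + |t| ^ g := continuous_const.add h
  refine h.mul (h1.rpow_const fun t => Or.inl ?_)
  have : 0 ≤ |t| ^ g := by positivity
  linarith

theorem blissKernel_of_pos {g n t : ℝ} (ht : 0 < t) :
    blissKernel g n t = t ^ g * (1 + t ^ g) ^ (-n) := by rw [blissKernel, abs_of_pos ht]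

theorem blissKernel_pos {g n t : ℝ} (ht : 0 < t) : 0 < blissKernel g n t := by
  rw [blissKernel_of_pos ht]; positivity

theorem integral_blissKernel_le {g n s : ℝ} (hg : 0 < g) (hn : 0 < n) (hs : 0 < s) :
    (∫ t in (0 : ℝ)..s, blissKernel g n t) ≤ s ^ (g + 1) / (g + 1) := by
  have : (∫ t in (0 : ℝ)..s, t ^ g) = s ^ (g + 1) / (g + 1) := by
    rw [integral_rpow (Or.inl (by linarith)), Real.zero_rpow (by linarith), sub_zero]
  rw [← this]
  refine intervalIntegral.integral_mono_on_of_le_Ioo hs.le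
    ((continuous_blissKernel n hg).intervalIntegrable _ _)
    (intervalIntegral.intervalIntegrable_rpow (Or.inl hg.le)) fun t ht => ?_
  have ht0 : 0 < t := ht.1
  rw [blissKernel_of_pos ht0]
  refine mul_le_of_le_one_right (by positivity) ?_
  exact Real.rpow_le_one_of_one_le_of_nonpos (by
    have : 0 < t ^ g := by positivity
    linarith) (by linarith)

/-- The Bliss inequality on `(0, X)` for functions of small mass. -/
theorem bliss_of_mass_lt {p q P m g n : ℝ} (hp : 1 < p) (hpq : p < q) (hP : P = p / (p - 1))
    (hm : m = q / P + 1) (hg : g = q / p - 1) (hn : n = p * q / (q - p))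
    {H : ℝ → ℝ} (hH : Continuous H) (hpos : ∀ x, 0 < H x) {X Y : ℝ} (hX : 0 < X) (hY : 0 < Y)
    (hlt : (∫ x in (0 : ℝ)..X, (∫ t in (0 : ℝ)..x, H t) ^ q * x ^ (-m)) <
      ∫ t in (0 : ℝ)..Y, blissKernel g n t) :
    (∫ x in (0 : ℝ)..X, (∫ t in (0 : ℝ)..x, H t) ^ q * x ^ (-m)) ≤
      P / q * ∫ x in (0 : ℝ)..X, H x ^ p := by
  have h1 : 0 < p - 1 := by linarith
  have h2 : 0 < q - p := by linarith
  have hp0 : 0 < p := by linarith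
  have hq0 : 0 < q := by linarith
  have hPpos : 0 < P := by rw [hP]; positivity
  have hm0 : 0 < m := by rw [hm]; positivity
  have hn1 : 1 < n := by rw [hn, lt_div_iff₀ h2]; nlinarith
  have hg0 : 0 < g := by rw [hg, show q / p - 1 = (q - p) / p by field_simp]; positivity
  have hmg : m + g = q := by rw [hm, hg, hP]; field_simp; ring
  set f : ℝ → ℝ := fun x => ∫ t in (0 : ℝ)..x, H t with hf
  set u : ℝ → ℝ := fun x => f x ^ q * x ^ (-m) with hu
  set M : ℝ → ℝ := fun x => ∫ t in (0 : ℝ)..x, u t with hM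
  obtain ⟨c, C, hc, hC, hcC⟩ := exists_linear_bounds hH hpos hX
  have hfc : Continuous f := continuous_primitive hH
  have hf0 : ∀ x, 0 < x → 0 < f x := fun x hx => primitive_pos hH hpos hx
  obtain ⟨huint, hMb⟩ := weighted_primitive_bounds hfc hq0 hmg hg0.le hX hc hC hcC
  obtain ⟨S, hS⟩ := exists_inverse_primitive (continuous_blissKernel n hg0)
    fun s hs => blissKernel_pos (g := g) (n := n) hs
  have hupos : ∀ x, 0 < x → 0 < u x := fun x hx => by
    have := hf0 x hx
    simp only [hu]; positivity
  have huint' : ∀ x ∈ Ioc 0 X, IntervalIntegrable u volume 0 x := fun x hx =>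
    huint.mono_set (by rw [uIcc_of_le hx.1.le, uIcc_of_le hX.le]; exact Icc_subset_Icc_right hx.2)
  have humeas : Measurable u := (hfc.measurable.pow_const q).mul (measurable_id.pow_const _)
  have hMd : ∀ x ∈ Ioc 0 X, HasDerivAt M (u x) x := fun x hx => by
    refine intervalIntegral.integral_hasDerivAt_right (huint' x hx)
      (humeas.stronglyMeasurable.stronglyMeasurableAtFilter) ?_
    exact (hfc.continuousAt.rpow_const (Or.inr hq0.le)).mul
      (continuousAt_id.rpow_const (Or.inl hx.1.ne'))
  have hMpos : ∀ x ∈ Ioc 0 X, 0 < M x := fun x hx =>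
    lt_of_lt_of_le (by have := hx.1; positivity) (hMb x hx).1
  have hMle : ∀ x ∈ Ioc 0 X, M x ≤ M X := fun x hx => by
    refine intervalIntegral.integral_mono_interval le_rfl hx.1.le hx.2 ?_ huint
    rw [Filter.EventuallyLE, ae_restrict_iff' measurableSet_Ioc]
    exact Filter.Eventually.of_forall fun t ht => (hupos t ht.1).le
  -- The bound on the total mass is used here: every `M x` lies in the range of the primitive of the
  -- kernel.
  have hSx : ∀ x ∈ Ioc 0 X, 0 < S (M x) ∧ (∫ t in (0 : ℝ)..S (M x), blissKernel g n t) = M x ∧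
      HasDerivAt S (blissKernel g n (S (M x)))⁻¹ (M x) := fun x hx =>
    hS (M x) (hMpos x hx) ⟨Y, hY, (hMle x hx).trans_lt hlt⟩
  set T : ℝ → ℝ := fun x => S (M x) with hT
  have hTd : ∀ x ∈ Ioc 0 X,
      HasDerivAt T (u x * (T x ^ g * (1 + T x ^ g) ^ (-n))⁻¹) x := fun x hx => by
    have := (hSx x hx).2.2.comp x (hMd x hx)
    rw [blissKernel_of_pos (hSx x hx).1, mul_comm] at this
    exact this
  set Ψ : ℝ → ℝ := fun y => m / p * M y + 1 / n * (T y * (1 + T y ^ g) ^ (1 - n)) +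
        P / q * (f y ^ m * y ^ (-(m / P)) * T y ^ (-(g / P))) with hΨ
  have hΨd : ∀ x ∈ Ioc 0 X, ∃ d, d ≤ P * m / (q * p) * H x ^ p ∧ HasDerivAt Ψ d x := fun x hx =>
    bliss_potential_hasDerivAt hp hpq hP hm hg hn hx.1 (hpos x) (hf0 x hx.1) (hSx x hx).1
      (hH.integral_hasStrictDerivAt 0 x).hasDerivAt (hMd x hx) (hTd x hx)
  choose! d hd hd' using hΨd
  have hHp : Continuous fun x => H x ^ p := hH.rpow_const fun x => Or.inr hp0.le
  set E : ℝ → ℝ := fun x => ∫ t in (0 : ℝ)..x, H t ^ p with hE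
  have hEd : ∀ x, HasDerivAt E (H x ^ p) x := fun x =>
    (hHp.integral_hasStrictDerivAt 0 x).hasDerivAt
  have hE0 : ∀ x, 0 ≤ x → 0 ≤ E x := fun x hx =>
    intervalIntegral.integral_nonneg hx fun t _ => Real.rpow_nonneg (hpos t).le _
  -- The formulas degenerate at `0`, so the derivative bound is integrated from `ε`; below, `Ψ ε` is
  -- shown to vanish in the limit.
  have hkey : ∀ ε ∈ Ioc 0 X, Ψ X ≤ P * m / (q * p) * E X + Ψ ε := by
    intro ε hε
    have hanti : AntitoneOn (fun x => Ψ x - P * m / (q * p) * E x) (Icc ε X) := by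
      have hall : ∀ x ∈ Icc ε X, HasDerivAt (fun x => Ψ x - P * m / (q * p) * E x)
          (d x - P * m / (q * p) * H x ^ p) x := fun x hx =>
        (hd' x ⟨hε.1.trans_le hx.1, hx.2⟩).sub ((hEd x).const_mul _)
      refine antitoneOn_of_hasDerivWithinAt_nonpos (convex_Icc _ _)
        (fun x hx => (hall x hx).continuousAt.continuousWithinAt)
        (fun x hx => (hall x (interior_subset hx)).hasDerivWithinAt) fun x hx => ?_
      have hx' := interior_subset hx
      have := hd x ⟨hε.1.trans_le hx'.1, hx'.2⟩
      linarith
    have h := hanti ⟨le_rfl, hε.2⟩ ⟨hε.2, le_rfl⟩ hε.2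
    have : 0 ≤ P * m / (q * p) * E ε := mul_nonneg (by positivity) (hE0 ε hε.1.le)
    simp only at h
    linarith
  have hlow : m / p * M X ≤ Ψ X := by
    have hXm : X ∈ Ioc 0 X := ⟨hX, le_rfl⟩
    have e1 := (hSx X hXm).1
    have e2 := hf0 X hX
    have e3 : 0 < T X := e1
    have : 0 ≤ 1 / n * (T X * (1 + T X ^ g) ^ (1 - n)) +
        P / q * (f X ^ m * X ^ (-(m / P)) * T X ^ (-(g / P))) := by
      have : 0 < n := by linarith
      positivity
    simp only [hΨ]; linarith
  -- bounds for the potential near zero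
  have hTlow : ∀ x ∈ Ioc 0 X, c ^ p * x ≤ T x := fun x hx => by
    have hT0 : 0 < T x := (hSx x hx).1
    have a1 := (hMb x hx).1
    have a2 := integral_blissKernel_le (n := n) hg0 (by linarith) hT0
    rw [(hSx x hx).2.1] at a2
    have a3 : c ^ q * x ^ (g + 1) ≤ T x ^ (g + 1) := by
      have := a1.trans a2
      rw [← mul_div_assoc] at this
      exact (div_le_div_iff_of_pos_right (by linarith)).1 this
    -- The power `c ^ p` arises from `p * (g + 1) = q`.
    have a4 : c ^ q * x ^ (g + 1) = (c ^ p * x) ^ (g + 1) := by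
      rw [Real.mul_rpow (by positivity) hx.1.le, ← Real.rpow_mul hc.le]
      congr 2; rw [hg]; field_simp; ring
    rw [a4] at a3
    have := hx.1
    exact (Real.rpow_le_rpow_iff (by positivity) hT0.le (by linarith)).1 a3
  have hΨup : ∀ x ∈ Ioc 0 X, Ψ x ≤ m / p * (C ^ q * (x ^ (g + 1) / (g + 1))) + 1 / n * T x +
      P / q * (C ^ m * (c ^ p) ^ (-(g / P))) * x := fun x hx => by
    have hT0 : 0 < T x := (hSx x hx).1
    have hx0 := hx.1
    have hn0 : 0 < n := by linarith
    simp only [hΨ]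
    have b1 := (hMb x hx).2
    have b2 : T x * (1 + T x ^ g) ^ (1 - n) ≤ T x := by
      refine mul_le_of_le_one_right hT0.le ?_
      refine Real.rpow_le_one_of_one_le_of_nonpos ?_ (by linarith)
      have : 0 < T x ^ g := by positivity
      linarith
    have b3 : f x ^ m * x ^ (-(m / P)) * T x ^ (-(g / P)) ≤ C ^ m * (c ^ p) ^ (-(g / P)) * x := by
      -- Since `T` is at least linear and `f` at most linear near `0`, the third term is bounded by
      -- a multiple of `x` to this power.
      have hexp : m - m / P - g / P = 1 := by rw [hm, hg, hP]; field_simp; ring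
      calc f x ^ m * x ^ (-(m / P)) * T x ^ (-(g / P))
          ≤ (C * x) ^ m * x ^ (-(m / P)) * (c ^ p * x) ^ (-(g / P)) := by
            gcongr ?_ * _ * ?_
            · exact Real.rpow_le_rpow (hf0 x hx0).le (hcC x ⟨hx0.le, hx.2⟩).2 hm0.le
            · refine Real.rpow_le_rpow_of_nonpos (by positivity) (hTlow x hx) ?_
              have : 0 < g / P := by positivity
              linarith
        _ = C ^ m * (c ^ p) ^ (-(g / P)) * (x ^ m * x ^ (-(m / P)) * x ^ (-(g / P))) := by
            rw [Real.mul_rpow hC.le hx0.le, Real.mul_rpow (by positivity) hx0.le]; ring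
        _ = C ^ m * (c ^ p) ^ (-(g / P)) * x := by
            rw [← Real.rpow_add hx0, ← Real.rpow_add hx0,
              show m + -(m / P) + -(g / P) = 1 by linarith, Real.rpow_one]
    have b1' : m / p * M x ≤ m / p * (C ^ q * (x ^ (g + 1) / (g + 1))) := by gcongr
    have b2' : 1 / n * (T x * (1 + T x ^ g) ^ (1 - n)) ≤ 1 / n * T x := by gcongr
    have b3' := mul_le_mul_of_nonneg_left b3 (show 0 ≤ P / q by positivity)
    linarith
  have hIoc : Ioc 0 X ∈ nhdsWithin (0 : ℝ) (Ioi 0) := Ioc_mem_nhdsGT hX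
  have hpow0 : Filter.Tendsto (fun x : ℝ => C ^ q * (x ^ (g + 1) / (g + 1)))
      (nhdsWithin 0 (Ioi 0)) (nhds 0) := by
    have hc1 : Continuous (fun x : ℝ => x ^ (g + 1)) :=
      Real.continuous_rpow_const (by linarith)
    have h := ((hc1.div_const (g + 1)).const_mul (C ^ q)).tendsto 0
    simp only [Real.zero_rpow (show g + 1 ≠ 0 by linarith), zero_div, mul_zero] at h
    exact h.mono_left nhdsWithin_le_nhds
  have hT0 : Filter.Tendsto T (nhdsWithin 0 (Ioi 0)) (nhds 0) := by
    rw [Metric.tendsto_nhds]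
    intro η hη
    have hNη : 0 < ∫ t in (0 : ℝ)..η, blissKernel g n t :=
      intervalIntegral.intervalIntegral_pos_of_pos_on
        ((continuous_blissKernel n hg0).intervalIntegrable _ _) (fun t ht => blissKernel_pos ht.1) hη
    filter_upwards [hIoc, hpow0.eventually (gt_mem_nhds hNη)] with x hx hxη
    have hTx : 0 < T x := (hSx x hx).1
    rw [Real.dist_eq, sub_zero, abs_of_pos hTx]
    by_contra hle
    push Not at hle
    have : (∫ t in (0 : ℝ)..η, blissKernel g n t) ≤ ∫ t in (0 : ℝ)..T x, blissKernel g n t := by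
      refine intervalIntegral.integral_mono_interval le_rfl hη.le hle ?_
        ((continuous_blissKernel n hg0).intervalIntegrable _ _)
      rw [Filter.EventuallyLE, ae_restrict_iff' measurableSet_Ioc]
      exact Filter.Eventually.of_forall fun t ht => (blissKernel_pos ht.1).le
    rw [(hSx x hx).2.1] at this
    have := (hMb x hx).2
    linarith
  have hlim : Filter.Tendsto (fun x => P * m / (q * p) * E X +
      (m / p * (C ^ q * (x ^ (g + 1) / (g + 1))) + 1 / n * T x +
      P / q * (C ^ m * (c ^ p) ^ (-(g / P))) * x)) (nhdsWithin 0 (Ioi 0))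
      (nhds (P * m / (q * p) * E X +
        (m / p * 0 + 1 / n * 0 + P / q * (C ^ m * (c ^ p) ^ (-(g / P))) * 0))) :=
    tendsto_const_nhds.add (((hpow0.const_mul _).add (hT0.const_mul _)).add
      ((Filter.tendsto_id.mono_left nhdsWithin_le_nhds).const_mul _))
  have hfin : Ψ X ≤ P * m / (q * p) * E X := by
    refine (ge_of_tendsto hlim ?_).trans (by simp)
    filter_upwards [hIoc] with x hx
    have := hkey x hx
    have := hΨup x hx
    linarith
  have hres := hlow.trans hfin
  have : m / p * M X ≤ m / p * (P / q * E X) := by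
    refine hres.trans (le_of_eq ?_); field_simp
  exact le_of_mul_le_mul_left this (by positivity)

/-- The Bliss inequality on `(0, X)` for positive continuous densities. -/
theorem bliss_interval {p q P m g n : ℝ} (hp : 1 < p) (hpq : p < q) (hP : P = p / (p - 1))
    (hm : m = q / P + 1) (hg : g = q / p - 1) (hn : n = p * q / (q - p))
    (hint : IntegrableOn (blissKernel g n) (Ioi 0)) {J : ℝ} (hJ0 : 0 < J)
    (hJ : (∫ t in Ioi 0, blissKernel g n t) = J)
    {H : ℝ → ℝ} (hH : Continuous H) (hpos : ∀ x, 0 < H x) {X : ℝ} (hX : 0 < X) :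
    (∫ x in (0 : ℝ)..X, (∫ t in (0 : ℝ)..x, H t) ^ q * x ^ (-m)) ≤
      J ^ (1 - q / p) * (P / q) ^ (q / p) * (∫ x in (0 : ℝ)..X, H x ^ p) ^ (q / p) := by
  have h1 : 0 < p - 1 := by linarith
  have h2 : 0 < q - p := by linarith
  have hp0 : 0 < p := by linarith
  have hq0 : 0 < q := by linarith
  have hPpos : 0 < P := by rw [hP]; positivity
  have hlim := intervalIntegral_tendsto_integral_Ioi 0 hint Filter.tendsto_id
  rw [hJ] at hlim
  set M := ∫ x in (0 : ℝ)..X, (∫ t in (0 : ℝ)..x, H t) ^ q * x ^ (-m) with hM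
  set E := ∫ x in (0 : ℝ)..X, H x ^ p with hE
  have hE0 : 0 ≤ E := intervalIntegral.integral_nonneg hX.le fun t _ => Real.rpow_nonneg (hpos t).le _
  rcases le_or_gt M 0 with hM0 | hM0
  · exact hM0.trans (by positivity)
  -- Replacing `H` by `l * H` multiplies the mass by `l ^ q` but the energy only by `l ^ p`.
  have hscale : ∀ l : ℝ, 0 < l → l ^ q * M < J → l ^ q * M ≤ P / q * (l ^ p * E) := by
    intro l hl hlt
    obtain ⟨Y, hY, hY'⟩ := ((hlim.eventually (lt_mem_nhds hlt)).and
      (Filter.eventually_gt_atTop 0)).exists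
    have eM : (∫ x in (0 : ℝ)..X, (∫ t in (0 : ℝ)..x, l * H t) ^ q * x ^ (-m)) = l ^ q * M := by
      rw [hM, ← intervalIntegral.integral_const_mul]
      refine intervalIntegral.integral_congr fun x hx => ?_
      rw [uIcc_of_le hX.le] at hx
      simp only [intervalIntegral.integral_const_mul]
      rw [Real.mul_rpow hl.le (intervalIntegral.integral_nonneg hx.1 fun t _ => (hpos t).le), mul_assoc]
    have eE : (∫ x in (0 : ℝ)..X, (l * H x) ^ p) = l ^ p * E := by
      rw [hE, ← intervalIntegral.integral_const_mul]
      refine intervalIntegral.integral_congr fun x hx => ?_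
      simp only [Real.mul_rpow hl.le (hpos x).le]
    have := bliss_of_mass_lt hp hpq hP hm hg hn (H := fun t => l * H t) (by fun_prop)
      (fun x => mul_pos hl (hpos x)) hX hY' (by rw [eM]; exact hY)
    rwa [eM, eE] at this
  have hred : ∀ l : ℝ, 0 < l → l ^ q * M < J → l ^ (q - p) * M ≤ P / q * E := by
    intro l hl hlt
    have := hscale l hl hlt
    have e : l ^ q = l ^ p * l ^ (q - p) := by rw [← Real.rpow_add hl]; congr 1; ring
    rw [e] at this
    have hlp : 0 < l ^ p := by positivity
    refine le_of_mul_le_mul_left (a := l ^ p) ?_ hlp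
    linarith
  -- The scale at which the mass is exactly `J`. The bound is available only for smaller `l`, hence
  -- the limit from the left.
  set l0 := (J / M) ^ (1 / q) with hl0
  have hl0pos : 0 < l0 := by positivity
  have hlimit : l0 ^ (q - p) * M ≤ P / q * E := by
    have ht : Filter.Tendsto (fun l : ℝ => l ^ (q - p) * M) (nhdsWithin l0 (Iio l0))
        (nhds (l0 ^ (q - p) * M)) :=
      ((Real.continuousAt_rpow_const l0 (q - p) (Or.inl hl0pos.ne')).tendsto.mono_left
        nhdsWithin_le_nhds).mul_const M
    refine le_of_tendsto ht ?_
    filter_upwards [Ioo_mem_nhdsLT hl0pos] with l hl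
    refine hred l hl.1 ?_
    have : l ^ q < l0 ^ q := Real.rpow_lt_rpow hl.1.le hl.2 hq0
    rw [hl0, ← Real.rpow_mul (by positivity), one_div_mul_cancel hq0.ne', Real.rpow_one] at this
    exact (lt_div_iff₀ hM0).1 this
  have e : l0 ^ (q - p) * M = (J ^ (q / p - 1) * M) ^ (p / q) := by
    rw [hl0, ← Real.rpow_mul (by positivity), Real.div_rpow hJ0.le hM0.le,
      Real.mul_rpow (by positivity) hM0.le, ← Real.rpow_mul hJ0.le, div_mul_eq_mul_div, mul_div_assoc]
    congr 1
    · congr 1; field_simp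
    · nth_rewrite 1 [← Real.rpow_one M]
      rw [← Real.rpow_sub hM0]; congr 1; field_simp; ring
  rw [e] at hlimit
  have h3 := Real.rpow_le_rpow (by positivity) hlimit (show 0 ≤ q / p by positivity)
  rw [← Real.rpow_mul (by positivity), show p / q * (q / p) = 1 by field_simp, Real.rpow_one,
    Real.mul_rpow (by positivity) hE0] at h3
  calc M = J ^ (1 - q / p) * (J ^ (q / p - 1) * M) := by
        rw [← mul_assoc, ← Real.rpow_add hJ0]; simp
    _ ≤ J ^ (1 - q / p) * ((P / q) ^ (q / p) * E ^ (q / p)) := by gcongr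
    _ = _ := by ring

/-! ### Reduction to positive continuous derivatives -/

theorem HardyAC0.eq_integral_deriv {f : ℝ → ℝ} (hf : f ∈ HardyAC0) {x : ℝ} (hx : 0 ≤ x) :
    f x = ∫ t in (0 : ℝ)..x, deriv f t := by
  rw [(hf.2 x hx).integral_deriv_eq_sub, hf.1, sub_zero]

theorem memLp_exp_neg_halfLebesgue {p : ℝ} (hp : 0 < p) :
    MemLp (fun x : ℝ => Real.exp (-x)) (ENNReal.ofReal p) halfLebesgue := by
  have hp' : ENNReal.ofReal p ≠ 0 := by simpa using hp
  rw [← integrable_norm_rpow_iff (by fun_prop) hp' ENNReal.ofReal_ne_top,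
    ENNReal.toReal_ofReal hp.le]
  have := integrableOn_exp_mul_Ioi (a := -p) (by linarith) 0
  refine this.congr_fun (fun x _ => ?_) measurableSet_Ioi
  simp only [Real.norm_eq_abs, Real.abs_exp, ← Real.exp_mul]
  ring_nf

/-- Continuous functions of compact support are dense in `L^p`. Taking absolute values and adding a
small multiple of `exp (-x)` makes them positive everywhere without leaving `L^p(0, ∞)`. -/
theorem exists_continuous_pos_approx {p : ℝ} (hp : 1 < p) {h : ℝ → ℝ}
    (hh : MemLp h (ENNReal.ofReal p) halfLebesgue) :
    ∃ H : ℕ → ℝ → ℝ, (∀ n, Continuous (H n)) ∧ (∀ n x, 0 < H n x) ∧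
      (∀ n, MemLp (H n) (ENNReal.ofReal p) halfLebesgue) ∧
      Filter.Tendsto (fun n => eLpNorm (H n - fun x => |h x|) (ENNReal.ofReal p) halfLebesgue)
        Filter.atTop (nhds 0) := by
  have hp0 : 0 < p := by linarith
  have hp1 : (1 : ℝ≥0∞) ≤ ENNReal.ofReal p := by
    rw [← ENNReal.ofReal_one]; exact ENNReal.ofReal_le_ofReal hp.le
  have hind : MemLp ((Ioi 0).indicator fun x => |h x|) (ENNReal.ofReal p) volume :=
    (memLp_indicator_iff_restrict measurableSet_Ioi).2 hh.norm
  set D := eLpNorm (fun x : ℝ => Real.exp (-x)) (ENNReal.ofReal p) halfLebesgue with hD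
  have hDtop : D ≠ ∞ := (memLp_exp_neg_halfLebesgue hp0).2.ne
  have hε : ∀ n : ℕ, ENNReal.ofReal (1 / ((n : ℝ) + 1)) ≠ 0 := fun n => by
    simp only [ne_eq, ENNReal.ofReal_eq_zero, not_le]; positivity
  choose k _ hk1 hk2 hk3 using fun n : ℕ =>
    hind.exists_hasCompactSupport_eLpNorm_sub_le ENNReal.ofReal_ne_top (hε n)
  have hexp := memLp_exp_neg_halfLebesgue hp0
  refine ⟨fun n x => |k n x| + 1 / ((n : ℝ) + 1) * Real.exp (-x), fun n => ?_, fun n x => ?_,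
    fun n => ?_, ?_⟩
  · have := hk2 n; fun_prop
  · have : 0 < 1 / ((n : ℝ) + 1) * Real.exp (-x) := by positivity
    have := abs_nonneg (k n x)
    linarith
  · exact ((hk3 n).restrict (Ioi 0)).norm.add (hexp.const_mul _)
  · have hbound : ∀ n : ℕ, eLpNorm ((fun x => |k n x| + 1 / ((n : ℝ) + 1) * Real.exp (-x)) -
        fun x => |h x|) (ENNReal.ofReal p) halfLebesgue ≤ ENNReal.ofReal (1 / ((n : ℝ) + 1)) * (1 + D) := by
      intro n
      have hsplit : ((fun x => |k n x| + 1 / ((n : ℝ) + 1) * Real.exp (-x)) - fun x => |h x|) =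
          (fun x => |k n x| - |h x|) + (1 / ((n : ℝ) + 1)) • fun x => Real.exp (-x) := by
        ext x; simp; ring
      rw [hsplit, mul_add, mul_one]
      refine (eLpNorm_add_le ?_ ?_ hp1).trans (add_le_add ?_ ?_)
      · exact ((hk3 n).restrict (Ioi 0)).1.norm.sub hh.1.norm
      · exact hexp.1.const_smul _
      · refine le_trans ?_ (hk1 n)
        refine le_trans ?_ (eLpNorm_mono_measure _ (Measure.restrict_le_self (s := Ioi 0)))
        refine eLpNorm_mono_ae ?_
        rw [halfLebesgue, ae_restrict_iff' measurableSet_Ioi]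
        refine Filter.Eventually.of_forall fun x hx => ?_
        simp only [Pi.sub_apply, indicator_of_mem hx, Real.norm_eq_abs]
        have := abs_abs_sub_abs_le (k n x) |h x|
        rwa [abs_abs, abs_sub_comm (k n x)] at this
      · rw [eLpNorm_const_smul]
        refine le_of_eq ?_
        congr 1
        rw [Real.enorm_of_nonneg (by positivity)]
    refine tendsto_of_tendsto_of_tendsto_of_le_of_le tendsto_const_nhds ?_ (fun _ => zero_le) hbound
    have h1 : Filter.Tendsto (fun n : ℕ => ENNReal.ofReal (1 / ((n : ℝ) + 1))) Filter.atTop (nhds 0) := by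
      have := ENNReal.tendsto_ofReal (tendsto_one_div_add_atTop_nhds_zero_nat (𝕜 := ℝ))
      simpa using this
    have := ENNReal.Tendsto.mul_const (b := 1 + D) h1 (Or.inr (by simp [hDtop]))
    simpa using this

/-- A Hardy-type inequality follows from its case of positive continuous derivatives. -/
theorem hardyIneq_of_continuous {p q : ℝ} (hp : 1 < p) {μ : Measure ℝ}
    (hμ : ∀ᵐ x ∂μ, 0 < x) {C : ℝ≥0∞} (hC0 : C ≠ 0) (hC : C ≠ ∞)
    (h : ∀ H : ℝ → ℝ, Continuous H → (∀ x, 0 < H x) →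
      eLpNorm (fun x => ∫ t in (0 : ℝ)..x, H t) (ENNReal.ofReal q) μ ≤
        C * eLpNorm H (ENNReal.ofReal p) halfLebesgue) :
    HardyIneq p q μ halfLebesgue C := by
  intro f hf
  by_cases hE : eLpNorm (deriv f) (ENNReal.ofReal p) halfLebesgue = ∞
  · rw [hE, ENNReal.mul_top hC0]; exact le_top
  have hp1 : (1 : ℝ≥0∞) ≤ ENNReal.ofReal p := by
    rw [← ENNReal.ofReal_one]; exact ENNReal.ofReal_le_ofReal hp.le
  have hmem : MemLp (deriv f) (ENNReal.ofReal p) halfLebesgue :=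
    ⟨(measurable_deriv f).aestronglyMeasurable, lt_top_iff_ne_top.2 hE⟩
  obtain ⟨H, hHc, hHp, hHm, hHt⟩ := exists_continuous_pos_approx hp hmem
  -- On the finite interval `(0, x]`, `L^p` convergence implies `L^1` convergence, so the primitives
  -- converge pointwise; this is what Fatou's lemma needs below.
  have hpt : ∀ x, 0 < x → Filter.Tendsto (fun n => ∫ t in (0 : ℝ)..x, H n t) Filter.atTop
      (nhds (∫ t in (0 : ℝ)..x, |deriv f t|)) := by
    intro x hx
    have hle : volume.restrict (Ioc 0 x) ≤ halfLebesgue :=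
      Measure.restrict_mono (fun t ht => ht.1) le_rfl
    have hi : ∀ g : ℝ → ℝ, MemLp g (ENNReal.ofReal p) halfLebesgue →
        Integrable g (volume.restrict (Ioc 0 x)) := fun g hg =>
      (hg.mono_measure hle).integrable hp1
    have hL1 := tendsto_integral_of_L1' (fun t => |deriv f t|) (hi _ hmem.norm).1
      (Filter.Eventually.of_forall fun n => hi _ (hHm n)) (l := Filter.atTop) (F := H) ?_
    · simpa only [intervalIntegral.integral_of_le hx.le] using hL1
    · set K := (volume.restrict (Ioc 0 x)) univ ^ (1 / (1 : ℝ≥0∞).toReal - 1 / (ENNReal.ofReal p).toReal)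
      have hK : K ≠ ∞ := by
        refine ENNReal.rpow_ne_top_of_nonneg ?_ (by simp)
        rw [ENNReal.toReal_ofReal (by linarith), ENNReal.toReal_one]
        rw [sub_nonneg]
        exact one_div_le_one_div_of_le one_pos hp.le
      have hup : ∀ n, eLpNorm (H n - fun t => |deriv f t|) 1 (volume.restrict (Ioc 0 x)) ≤
          eLpNorm (H n - fun t => |deriv f t|) (ENNReal.ofReal p) halfLebesgue * K := fun n => by
        refine (eLpNorm_le_eLpNorm_mul_rpow_measure_univ hp1 ?_).trans ?_
        · exact (((hHm n).sub hmem.norm).mono_measure hle).1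
        · gcongr
      refine tendsto_of_tendsto_of_tendsto_of_le_of_le tendsto_const_nhds ?_ (fun _ => zero_le) hup
      simpa using ENNReal.Tendsto.mul_const (b := K) hHt (Or.inr hK)
  calc eLpNorm f (ENNReal.ofReal q) μ
      ≤ eLpNorm (fun x => ∫ t in (0 : ℝ)..x, |deriv f t|) (ENNReal.ofReal q) μ := by
        refine eLpNorm_mono_ae ?_
        filter_upwards [hμ] with x hx
        rw [HardyAC0.eq_integral_deriv hf hx.le, Real.norm_eq_abs, Real.norm_eq_abs]
        refine (intervalIntegral.abs_integral_le_integral_abs hx.le).trans (le_abs_self _)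
    _ ≤ Filter.atTop.liminf fun n => eLpNorm (fun x => ∫ t in (0 : ℝ)..x, H n t) (ENNReal.ofReal q) μ := by
        refine Lp.eLpNorm_lim_le_liminf_eLpNorm
          (fun n => (continuous_primitive (hHc n)).aestronglyMeasurable) _ ?_
        filter_upwards [hμ] with x hx using hpt x hx
    _ ≤ Filter.atTop.liminf fun n => C * (eLpNorm (H n - fun x => |deriv f x|) (ENNReal.ofReal p) halfLebesgue +
          eLpNorm (deriv f) (ENNReal.ofReal p) halfLebesgue) := by
        refine Filter.liminf_le_liminf (Filter.Eventually.of_forall fun n => ?_)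
        refine (h (H n) (hHc n) (hHp n)).trans ?_
        gcongr
        have e : H n = (H n - fun x => |deriv f x|) + fun x => |deriv f x| := by
          ext x; simp
        calc eLpNorm (H n) (ENNReal.ofReal p) halfLebesgue
            = eLpNorm ((H n - fun x => |deriv f x|) + fun x => |deriv f x|) (ENNReal.ofReal p)
                halfLebesgue := by rw [← e]
          _ ≤ _ := eLpNorm_add_le ((hHm n).sub hmem.norm).1 hmem.norm.1 hp1
          _ = _ := by congr 1; exact eLpNorm_norm (deriv f)
    _ = C * eLpNorm (deriv f) (ENNReal.ofReal p) halfLebesgue := by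
        refine Filter.Tendsto.liminf_eq ?_
        have := ENNReal.Tendsto.const_mul (a := C)
          (hHt.add_const (eLpNorm (deriv f) (ENNReal.ofReal p) halfLebesgue)) (Or.inr hC)
        simpa using this

/-! ### From bounded intervals to norms on the half-line -/

theorem ae_halfLebesgue_pos : ∀ᵐ x ∂halfLebesgue, 0 < x := by
  rw [halfLebesgue]; exact ae_restrict_mem measurableSet_Ioi

theorem ae_blissMeasure_pos (p q : ℝ) : ∀ᵐ x ∂blissMeasure p q, 0 < x :=
  (withDensity_absolutelyContinuous _ _).ae_le ae_halfLebesgue_pos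

theorem lintegral_blissMeasure {p q m : ℝ} (hm : m = q / p.conjExponent + 1) {F : ℝ → ℝ≥0∞}
    (hF : Measurable F) :
    ∫⁻ x, F x ∂blissMeasure p q = ∫⁻ x in Ioi 0, ENNReal.ofReal (x ^ (-m)) * F x := by
  have e : -q / p.conjExponent - 1 = -m := by rw [hm]; ring
  rw [blissMeasure, e, lintegral_withDensity_eq_lintegral_mul _ (by fun_prop) hF]
  rfl

/-- The `L^r` norm as an integral of a real power. -/
theorem eLpNorm_ofReal_eq {r : ℝ} (hr : 0 < r) (f : ℝ → ℝ) (μ : Measure ℝ) :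
    eLpNorm f (ENNReal.ofReal r) μ = (∫⁻ x, ENNReal.ofReal (|f x| ^ r) ∂μ) ^ (1 / r) := by
  rw [eLpNorm_eq_lintegral_rpow_enorm_toReal (by simpa using hr) ENNReal.ofReal_ne_top,
    ENNReal.toReal_ofReal hr.le]
  congr 1
  refine lintegral_congr fun x => ?_
  rw [← ENNReal.ofReal_rpow_of_nonneg (abs_nonneg _) hr.le, Real.enorm_eq_ofReal_abs]

theorem eLpNorm_blissMeasure {p q m r : ℝ} (hm : m = q / p.conjExponent + 1) (hr : 0 < r)
    {f : ℝ → ℝ} (hf : Measurable f) (hf0 : ∀ x, 0 < x → 0 ≤ f x) :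
    eLpNorm f (ENNReal.ofReal r) (blissMeasure p q) =
      (∫⁻ x in Ioi 0, ENNReal.ofReal (f x ^ r * x ^ (-m))) ^ (1 / r) := by
  rw [eLpNorm_ofReal_eq hr, lintegral_blissMeasure hm (by fun_prop)]
  congr 1
  refine setLIntegral_congr_fun measurableSet_Ioi fun x hx => ?_
  have hx0 : (0 : ℝ) < x := hx
  rw [abs_of_nonneg (hf0 x hx), mul_comm, ENNReal.ofReal_mul (by have := hf0 x hx; positivity)]

theorem lintegral_Ioi_le_of_intervalIntegral_le {u : ℝ → ℝ} (hu0 : ∀ x, 0 < x → 0 ≤ u x)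
    (hum : Measurable u) (hu : ∀ X, 0 < X → IntervalIntegrable u volume 0 X) {R : ℝ≥0∞}
    (h : ∀ X, 0 < X → ENNReal.ofReal (∫ x in (0 : ℝ)..X, u x) ≤ R) :
    ∫⁻ x in Ioi 0, ENNReal.ofReal (u x) ≤ R := by
  have hcov : AECover (volume.restrict (Ioi (0 : ℝ))) Filter.atTop (fun n : ℕ => Iic (n : ℝ)) :=
    aecover_Iic tendsto_natCast_atTop_atTop
  have ht := hcov.lintegral_tendsto_of_countably_generated
    (f := fun x => ENNReal.ofReal (u x)) (by fun_prop)
  refine le_of_tendsto ht ?_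
  filter_upwards [Filter.eventually_gt_atTop 0] with n hn
  have hn' : (0 : ℝ) < n := by exact_mod_cast hn
  refine le_trans (le_of_eq ?_) (h n hn')
  rw [Measure.restrict_restrict measurableSet_Iic, Iic_inter_Ioi,
    intervalIntegral.integral_of_le hn'.le]
  refine (ofReal_integral_eq_lintegral_ofReal ((intervalIntegrable_iff_integrableOn_Ioc_of_le
    hn'.le).1 (hu n hn')) ?_).symm
  rw [Filter.EventuallyLE, ae_restrict_iff' measurableSet_Ioc]
  exact Filter.Eventually.of_forall fun t ht => hu0 t ht.1

theorem ofReal_intervalIntegral_rpow_le {r : ℝ} (hr : 0 < r) {H : ℝ → ℝ} (hH : Continuous H)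
    (hpos : ∀ x, 0 < H x) {X : ℝ} (hX : 0 < X) :
    ENNReal.ofReal (∫ x in (0 : ℝ)..X, H x ^ r) ≤ ∫⁻ x, ENNReal.ofReal (|H x| ^ r) ∂halfLebesgue := by
  have hc : Continuous fun x => H x ^ r := hH.rpow_const fun x => Or.inr hr.le
  rw [intervalIntegral.integral_of_le hX.le, ofReal_integral_eq_lintegral_ofReal
    ((intervalIntegrable_iff_integrableOn_Ioc_of_le hX.le).1 (hc.intervalIntegrable _ _))
    (Filter.Eventually.of_forall fun t => Real.rpow_nonneg (hpos t).le _)]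
  simp only [abs_of_pos (hpos _)]
  exact lintegral_mono_set fun t ht => ht.1

/-- Passage from bounds on finite intervals to a norm inequality. -/
theorem eLpNorm_primitive_le {p q m g r s K : ℝ} (hm : m = q / p.conjExponent + 1) (hr : 0 < r)
    (hs : 0 < s) (hmg : m + g = s) (hg : 0 ≤ g) (hK : 0 ≤ K)
    {H : ℝ → ℝ} (hH : Continuous H) (hpos : ∀ x, 0 < H x)
    (h : ∀ X, 0 < X → (∫ x in (0 : ℝ)..X, (∫ t in (0 : ℝ)..x, H t) ^ s * x ^ (-m)) ≤
      K * (∫ x in (0 : ℝ)..X, H x ^ r) ^ (s / r)) :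
    eLpNorm (fun x => ∫ t in (0 : ℝ)..x, H t) (ENNReal.ofReal s) (blissMeasure p q) ≤
      ENNReal.ofReal (K ^ (1 / s)) * eLpNorm H (ENNReal.ofReal r) halfLebesgue := by
  have hc := continuous_primitive hH
  have hf0 : ∀ x, 0 < x → 0 < ∫ t in (0 : ℝ)..x, H t := fun x hx => primitive_pos hH hpos hx
  rw [eLpNorm_blissMeasure hm hs hc.measurable fun x hx => (hf0 x hx).le, eLpNorm_ofReal_eq hr]
  set E := ∫⁻ x, ENNReal.ofReal (|H x| ^ r) ∂halfLebesgue
  have hmain : ∫⁻ x in Ioi 0, ENNReal.ofReal ((∫ t in (0 : ℝ)..x, H t) ^ s * x ^ (-m)) ≤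
      ENNReal.ofReal K * E ^ (s / r) := by
    refine lintegral_Ioi_le_of_intervalIntegral_le (fun x hx => ?_) ?_ (fun X hX => ?_)
      fun X hX => ?_
    · have := hf0 x hx; positivity
    · exact (hc.measurable.pow_const s).mul (measurable_id.pow_const _)
    · obtain ⟨c, C, hc0, hC, hcC⟩ := exists_linear_bounds hH hpos hX
      exact (weighted_primitive_bounds hc hs hmg hg hX hc0 hC hcC).1
    · refine (ENNReal.ofReal_le_ofReal (h X hX)).trans ?_
      have h0 : 0 ≤ ∫ x in (0 : ℝ)..X, H x ^ r :=
        intervalIntegral.integral_nonneg hX.le fun t _ => Real.rpow_nonneg (hpos t).le _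
      rw [ENNReal.ofReal_mul hK, ← ENNReal.ofReal_rpow_of_nonneg h0 (by positivity)]
      gcongr
      exact ofReal_intervalIntegral_rpow_le hr hH hpos hX
  calc _ ≤ (ENNReal.ofReal K * E ^ (s / r)) ^ (1 / s) := by gcongr
    _ = _ := by
      rw [ENNReal.mul_rpow_of_nonneg _ _ (by positivity), ← ENNReal.rpow_mul,
        ENNReal.ofReal_rpow_of_nonneg hK (by positivity)]
      congr 2; field_simp

theorem hardyIneq_bliss {p q P m g n : ℝ} (hp : 1 < p) (hpq : p < q) (hP : P = p.conjExponent)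
    (hm : m = q / P + 1) (hg : g = q / p - 1) (hn : n = p * q / (q - p))
    (hint : IntegrableOn (blissKernel g n) (Ioi 0)) {J : ℝ} (hJ0 : 0 < J)
    (hJ : (∫ t in Ioi 0, blissKernel g n t) = J) :
    HardyIneq p q (blissMeasure p q) halfLebesgue
      (ENNReal.ofReal ((J ^ (1 - q / p) * (P / q) ^ (q / p)) ^ (1 / q))) := by
  have h1 : 0 < p - 1 := by linarith
  have h2 : 0 < q - p := by linarith
  have hp0 : 0 < p := by linarith
  have hq0 : 0 < q := by linarith
  have hP' : P = p / (p - 1) := hP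
  have hPpos : 0 < P := by rw [hP']; positivity
  have hg0 : 0 < g := by rw [hg, show q / p - 1 = (q - p) / p by field_simp]; positivity
  have hmg : m + g = q := by rw [hm, hg, hP']; field_simp; ring
  have hA : 0 < (J ^ (1 - q / p) * (P / q) ^ (q / p)) ^ (1 / q) := by positivity
  refine hardyIneq_of_continuous hp (ae_blissMeasure_pos p q) (by simpa using hA)
    ENNReal.ofReal_ne_top fun H hH hpos => ?_
  exact eLpNorm_primitive_le (by rw [hm, hP]) hp0 hq0 hmg hg0.le (by positivity) hH hpos
    fun X hX => bliss_interval hp hpq hP' hm hg hn hint hJ0 hJ hH hpos hX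

/-! ### Hardy's inequality with equal exponents -/

/-- Hardy's inequality on an interval. -/
theorem hardy_interval {m : ℝ} (hm : 1 < m) {H : ℝ → ℝ} (hH : Continuous H) (hpos : ∀ x, 0 < H x)
    {X : ℝ} (hX : 0 < X) :
    (∫ x in (0 : ℝ)..X, (∫ t in (0 : ℝ)..x, H t) ^ m * x ^ (-m)) ≤
      (m / (m - 1)) ^ m * ∫ x in (0 : ℝ)..X, H x ^ m := by
  have h1 : 0 < m - 1 := by linarith
  have hm0 : 0 < m := by linarith
  set f : ℝ → ℝ := fun x => ∫ t in (0 : ℝ)..x, H t with hf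
  set u : ℝ → ℝ := fun x => f x ^ m * x ^ (-m) with hu
  set M : ℝ → ℝ := fun x => ∫ t in (0 : ℝ)..x, u t with hM
  set E : ℝ → ℝ := fun x => ∫ t in (0 : ℝ)..x, H t ^ m with hE
  obtain ⟨c, C, hc, hC, hcC⟩ := exists_linear_bounds hH hpos hX
  have hfc : Continuous f := continuous_primitive hH
  have hf0 : ∀ x, 0 < x → 0 < f x := fun x hx => primitive_pos hH hpos hx
  obtain ⟨huint, hMb⟩ := weighted_primitive_bounds hfc hm0 (add_zero m) le_rfl hX hc hC hcC
  have huint' : ∀ x ∈ Ioc 0 X, IntervalIntegrable u volume 0 x := fun x hx =>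
    huint.mono_set (by rw [uIcc_of_le hx.1.le, uIcc_of_le hX.le]; exact Icc_subset_Icc_right hx.2)
  have humeas : Measurable u := (hfc.measurable.pow_const m).mul (measurable_id.pow_const _)
  have hMd : ∀ x ∈ Ioc 0 X, HasDerivAt M (u x) x := fun x hx => by
    refine intervalIntegral.integral_hasDerivAt_right (huint' x hx)
      (humeas.stronglyMeasurable.stronglyMeasurableAtFilter) ?_
    exact (hfc.continuousAt.rpow_const (Or.inr hm0.le)).mul
      (continuousAt_id.rpow_const (Or.inl hx.1.ne'))
  have hHm : Continuous fun x => H x ^ m := hH.rpow_const fun x => Or.inr hm0.le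
  have hEd : ∀ x, HasDerivAt E (H x ^ m) x := fun x =>
    (hHm.integral_hasStrictDerivAt 0 x).hasDerivAt
  have hE0 : ∀ x, 0 ≤ x → 0 ≤ E x := fun x hx =>
    intervalIntegral.integral_nonneg hx fun t _ => Real.rpow_nonneg (hpos t).le _
  -- The middle term is a boundary term, nonnegative at `X` and at most linear near `0`. Its
  -- coefficient makes the powers of `f x / x` cancel exactly after Young's inequality, so that `Φ`
  -- decreases.
  set Φ : ℝ → ℝ := fun x => M x + m / (m - 1) * (f x ^ m * x ^ (1 - m)) - (m / (m - 1)) ^ m * E x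
    with hΦ
  have hd : ∀ x ∈ Ioc 0 X, ∃ d, d ≤ 0 ∧ HasDerivAt Φ d x := by
    intro x hx
    have hx0 := hx.1
    have hF := hf0 x hx0
    have hfd : HasDerivAt f (H x) x := (hH.integral_hasStrictDerivAt 0 x).hasDerivAt
    have e := ((hMd x hx).add (((hfd.rpow_const (p := m) (Or.inl hF.ne')).mul
      ((hasDerivAt_id x).rpow_const (p := 1 - m) (Or.inl hx0.ne'))).const_mul (m / (m - 1)))).sub
      ((hEd x).const_mul ((m / (m - 1)) ^ m))
    refine ⟨_, ?_, e⟩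
    simp only [id, one_mul]
    have hc' : m.HolderConjugate (m / (m - 1)) := by
      rw [Real.holderConjugate_iff]; refine ⟨hm, ?_⟩; field_simp; ring
    have Y := Real.young_inequality_of_nonneg (a := m / (m - 1) * H x) (b := (f x / x) ^ (m - 1))
      (by have := hpos x; positivity) (by positivity) hc'
    rw [← Real.rpow_mul (by positivity), show (m - 1) * (m / (m - 1)) = m by field_simp,
      Real.mul_rpow (by positivity) (hpos x).le] at Y
    have r1 : u x = (f x / x) ^ m := by
      simp only [hu]; rw [Real.div_rpow hF.le hx0.le, Real.rpow_neg hx0.le]; rfl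
    have r2 : f x ^ (m - 1) * x ^ (1 - m) = (f x / x) ^ (m - 1) := by
      rw [Real.div_rpow hF.le hx0.le, show 1 - m = -(m - 1) by ring, Real.rpow_neg hx0.le]; rfl
    have r3 : f x ^ m * x ^ (1 - m - 1) = (f x / x) ^ m := by
      rw [← r1]; simp only [hu]; congr 2; ring
    have e1 : H x * m * f x ^ (m - 1) * x ^ (1 - m) + f x ^ m * ((1 - m) * x ^ (1 - m - 1)) =
        m * H x * (f x / x) ^ (m - 1) - (m - 1) * (f x / x) ^ m := by
      rw [← r2, ← r3]; ring
    rw [e1, r1]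
    have Y' := mul_le_mul_of_nonneg_left Y hm0.le
    have e2 : m * ((m / (m - 1)) ^ m * H x ^ m / m + (f x / x) ^ m / (m / (m - 1))) =
        (m / (m - 1)) ^ m * H x ^ m + (m - 1) * (f x / x) ^ m := by field_simp
    rw [e2] at Y'
    have e3 : m / (m - 1) * (m * H x * (f x / x) ^ (m - 1) - (m - 1) * (f x / x) ^ m) =
       m * (m / (m - 1) * H x * (f x / x) ^ (m - 1)) - m * (f x / x) ^ m := by field_simp
    rw [e3]
    linarith
  choose! d hd0 hd' using hd
  have hkey : ∀ ε ∈ Ioc 0 X, Φ X ≤ (C ^ m + m / (m - 1) * C ^ m) * ε := by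
    intro ε hε
    have hε0 := hε.1
    have hanti : AntitoneOn Φ (Icc ε X) := by
      refine antitoneOn_of_hasDerivWithinAt_nonpos (convex_Icc _ _)
        (fun x hx => (hd' x ⟨hε.1.trans_le hx.1, hx.2⟩).continuousAt.continuousWithinAt)
        (fun x hx => (hd' x ⟨hε.1.trans_le (interior_subset hx).1,
          (interior_subset hx).2⟩).hasDerivWithinAt) fun x hx => ?_
      have hx' := interior_subset hx
      exact hd0 x ⟨hε.1.trans_le hx'.1, hx'.2⟩
    refine (hanti ⟨le_rfl, hε.2⟩ ⟨hε.2, le_rfl⟩ hε.2).trans ?_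
    have b1 := (hMb ε hε).2
    simp only [zero_add, Real.rpow_one, div_one] at b1
    have b2 : f ε ^ m * ε ^ (1 - m) ≤ C ^ m * ε := by
      calc f ε ^ m * ε ^ (1 - m) ≤ (C * ε) ^ m * ε ^ (1 - m) := by
            gcongr
            · exact (hf0 ε hε0).le
            · exact (hcC ε ⟨hε0.le, hε.2⟩).2
        _ = C ^ m * ε := by
            rw [Real.mul_rpow hC.le hε0.le, mul_assoc, ← Real.rpow_add hε0]; simp
    have b3 : 0 ≤ (m / (m - 1)) ^ m * E ε := mul_nonneg (by positivity) (hE0 ε hε0.le)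
    have b2' := mul_le_mul_of_nonneg_left b2 (show 0 ≤ m / (m - 1) by positivity)
    have b1' : M ε ≤ C ^ m * ε := b1
    simp only [hΦ]
    linarith
  have hfin : Φ X ≤ 0 := by
    have hlim : Filter.Tendsto (fun ε => (C ^ m + m / (m - 1) * C ^ m) * ε)
        (nhdsWithin (0 : ℝ) (Ioi 0)) (nhds ((C ^ m + m / (m - 1) * C ^ m) * 0)) :=
      (Filter.tendsto_id.mono_left nhdsWithin_le_nhds).const_mul _
    rw [mul_zero] at hlim
    refine ge_of_tendsto hlim ?_
    filter_upwards [Ioc_mem_nhdsGT hX] with ε hε using hkey ε hε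
  have h0 : 0 ≤ m / (m - 1) * (f X ^ m * X ^ (1 - m)) := by
    have := hf0 X hX; positivity
  simp only [hΦ] at hfin
  linarith

/-- The weight is `x ^ (-m)`, so with both exponents equal to `m` this is the classical Hardy
inequality. -/
theorem hardyIneq_hardy {p q m : ℝ} (hm : m = q / p.conjExponent + 1) (hm1 : 1 < m) :
    HardyIneq m m (blissMeasure p q) halfLebesgue (ENNReal.ofReal (m / (m - 1))) := by
  have h1 : 0 < m - 1 := by linarith
  have hm0 : 0 < m := by linarith
  have hA : 0 < m / (m - 1) := by positivity
  refine hardyIneq_of_continuous hm1 (ae_blissMeasure_pos p q) (by simpa using hA)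
    ENNReal.ofReal_ne_top fun H hH hpos => ?_
  have := eLpNorm_primitive_le hm hm0 hm0 (add_zero m) le_rfl (K := (m / (m - 1)) ^ m)
    (by positivity) hH hpos fun X hX => by
      rw [div_self hm0.ne', Real.rpow_one]; exact hardy_interval hm1 hH hpos hX
  rwa [← Real.rpow_mul hA.le, mul_one_div_cancel hm0.ne', Real.rpow_one] at this

/-! ### Beta integrals and the value of the constant -/

/-- A nonzero Bochner integral certifies integrability, because the integral of a non-integrable
function is `0` by convention. -/
theorem setLIntegral_ofReal_eq_of_integral_eq {s : Set ℝ} (hs : MeasurableSet s) {f : ℝ → ℝ}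
    (hf : ∀ x ∈ s, 0 ≤ f x) {c : ℝ} (hc : c ≠ 0) (h : ∫ x in s, f x = c) :
    ∫⁻ x in s, ENNReal.ofReal (f x) = ENNReal.ofReal c := by
  have hint : IntegrableOn f s := by
    by_contra hn
    exact hc (h ▸ integral_undef hn)
  rw [← h, ofReal_integral_eq_lintegral_ofReal hint]
  rw [Filter.EventuallyLE, ae_restrict_iff' hs]
  exact Filter.Eventually.of_forall hf

/-- The Beta integral on the half-line after the substitution `β s ^ g`. -/
theorem lintegral_rpow_mul_one_add_rpow {d g n β : ℝ} (hd : -1 < d) (hg : 0 < g)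
    (hdn : (d + 1) / g < n) (hβ : 0 < β) :
    ∫⁻ s in Ioi 0, ENNReal.ofReal (s ^ d * (1 + β * s ^ g) ^ (-n)) =
      ENNReal.ofReal (β ^ (-(d + 1) / g) * (1 / g) * Real.Gamma ((d + 1) / g) *
        Real.Gamma (n - (d + 1) / g) / Real.Gamma n) := by
  have hdg : 0 < (d + 1) / g := div_pos (by linarith) hg
  have hn : 0 < n := hdg.trans hdn
  have hΓn := Real.Gamma_pos_of_pos hn
  have hΓ1 := Real.Gamma_pos_of_pos hdg
  have hΓ2 := Real.Gamma_pos_of_pos (show 0 < n - (d + 1) / g by linarith)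
  -- The negative power times `Γ(n)` is a Gamma integral in `y`. After Tonelli the integral in `s`
  -- is a Gamma integral too, and a third one in `y` remains.
  have hs1 : ∀ s ∈ Ioi (0 : ℝ), ENNReal.ofReal (s ^ d * (1 + β * s ^ g) ^ (-n)) *
      ENNReal.ofReal (Real.Gamma n) =
      ∫⁻ y in Ioi 0, ENNReal.ofReal (y ^ (n - 1) * Real.exp (-y)) *
        ENNReal.ofReal (s ^ d * Real.exp (-(β * y) * s ^ g)) := by
    intro s hs
    have hs0 : (0 : ℝ) < s := hs
    have hr : 0 < 1 + β * s ^ g := by positivity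
    have h1 := Real.integral_rpow_mul_exp_neg_mul_Ioi hn hr
    have h2 := setLIntegral_ofReal_eq_of_integral_eq measurableSet_Ioi
      (fun y hy => by have : (0 : ℝ) < y := hy; positivity) (by positivity) h1
    rw [← ENNReal.ofReal_mul (by positivity),
      show s ^ d * (1 + β * s ^ g) ^ (-n) * Real.Gamma n =
        s ^ d * ((1 / (1 + β * s ^ g)) ^ n * Real.Gamma n) by
          rw [one_div, Real.inv_rpow hr.le, Real.rpow_neg hr.le]; ring,
      ENNReal.ofReal_mul (by positivity), ← h2, ← lintegral_const_mul _ (by fun_prop)]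
    refine setLIntegral_congr_fun measurableSet_Ioi fun y hy => ?_
    have hy0 : (0 : ℝ) < y := hy
    rw [← ENNReal.ofReal_mul (by positivity), ← ENNReal.ofReal_mul (by positivity)]
    congr 1
    rw [show -((1 + β * s ^ g) * y) = -y + -(β * y) * s ^ g by ring, Real.exp_add]
    ring
  have hy1 : ∀ y ∈ Ioi (0 : ℝ), (∫⁻ s in Ioi 0, ENNReal.ofReal (y ^ (n - 1) * Real.exp (-y)) *
        ENNReal.ofReal (s ^ d * Real.exp (-(β * y) * s ^ g))) =
      ENNReal.ofReal (β ^ (-(d + 1) / g) * (1 / g) * Real.Gamma ((d + 1) / g)) *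
        ENNReal.ofReal (y ^ (n - (d + 1) / g - 1) * Real.exp (-(1 * y))) := by
    intro y hy
    have hy0 : (0 : ℝ) < y := hy
    have h1 := integral_rpow_mul_exp_neg_mul_rpow hg hd (show 0 < β * y by positivity)
    have h2 := setLIntegral_ofReal_eq_of_integral_eq measurableSet_Ioi
      (fun s hs => by have : (0 : ℝ) < s := hs; positivity) (by positivity) h1
    rw [lintegral_const_mul _ (by fun_prop), h2, ← ENNReal.ofReal_mul (by positivity),
      ← ENNReal.ofReal_mul (by positivity)]
    congr 1
    rw [Real.mul_rpow hβ.le hy0.le, show n - (d + 1) / g - 1 = (n - 1) + -(d + 1) / g by ring,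
      Real.rpow_add hy0, one_mul]
    ring
  have hmul : (∫⁻ s in Ioi 0, ENNReal.ofReal (s ^ d * (1 + β * s ^ g) ^ (-n))) *
      ENNReal.ofReal (Real.Gamma n) =
      ENNReal.ofReal (β ^ (-(d + 1) / g) * (1 / g) * Real.Gamma ((d + 1) / g)) *
        ENNReal.ofReal (Real.Gamma (n - (d + 1) / g)) := by
    rw [← lintegral_mul_const _ (by fun_prop), setLIntegral_congr_fun measurableSet_Ioi hs1,
      lintegral_lintegral_swap, setLIntegral_congr_fun measurableSet_Ioi hy1,
      lintegral_const_mul _ (by fun_prop)]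
    · congr 1
      have h1 := Real.integral_rpow_mul_exp_neg_mul_Ioi (show 0 < n - (d + 1) / g by linarith) one_pos
      rw [div_one, Real.one_rpow, one_mul] at h1
      exact setLIntegral_ofReal_eq_of_integral_eq measurableSet_Ioi
        (fun y hy => by have : (0 : ℝ) < y := hy; positivity) hΓ2.ne' h1
    · refine Measurable.aemeasurable ?_
      simp only [Function.uncurry_def]
      fun_prop
  rw [← ENNReal.ofReal_mul (by positivity)] at hmul
  rw [ENNReal.ofReal_div_of_pos hΓn, ← hmul, ENNReal.mul_div_cancel_right
    (by simpa using hΓn) ENNReal.ofReal_ne_top]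

theorem integrableOn_of_lintegral_ofReal_eq {s : Set ℝ} (hs : MeasurableSet s) {f : ℝ → ℝ}
    (hfm : Measurable f) (hf : ∀ x ∈ s, 0 ≤ f x) {c : ℝ} (hc : 0 ≤ c)
    (h : ∫⁻ x in s, ENNReal.ofReal (f x) = ENNReal.ofReal c) :
    IntegrableOn f s ∧ ∫ x in s, f x = c := by
  have hae : 0 ≤ᵐ[volume.restrict s] f := by
    rw [Filter.EventuallyLE, ae_restrict_iff' hs]
    exact Filter.Eventually.of_forall hf
  refine ⟨⟨hfm.aestronglyMeasurable, ?_⟩, ?_⟩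
  · rw [hasFiniteIntegral_iff_ofReal hae, h]; exact ENNReal.ofReal_lt_top
  · rw [integral_eq_lintegral_of_nonneg_ae hae hfm.aestronglyMeasurable, h, ENNReal.toReal_ofReal hc]

/-- The energy `∫₀^∞ (1 + s ^ g) ^ (-n) ds` of the extremal function. -/
noncomputable def blissEnergy (p q : ℝ) : ℝ :=
  Real.Gamma (q / (q - p)) * Real.Gamma (p * (q - 1) / (q - p)) / Real.Gamma (p * q / (q - p))

theorem blissEnergy_pos {p q : ℝ} (hp : 1 < p) (hpq : p < q) : 0 < blissEnergy p q := by
  have h1 : 0 < q - p := by linarith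
  have h2 : 0 < q - 1 := by linarith
  have h3 : 0 < q := by linarith
  have h4 : 0 < p := by linarith
  have a1 := Real.Gamma_pos_of_pos (show 0 < q / (q - p) by positivity)
  have a2 := Real.Gamma_pos_of_pos (show 0 < p * (q - 1) / (q - p) by positivity)
  have a3 := Real.Gamma_pos_of_pos (show 0 < p * q / (q - p) by positivity)
  unfold blissEnergy; positivity

theorem sharpFactor_eq {p q : ℝ} (hp : 1 < p) (hpq : p < q) :
    sharpFactor p q = blissEnergy p q ^ (-(1 / p - 1 / q)) := by
  rw [Real.rpow_neg (blissEnergy_pos hp hpq).le, ← Real.inv_rpow (blissEnergy_pos hp hpq).le,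
    sharpFactor, blissEnergy, inv_div]

theorem lintegral_energy {p q g n β : ℝ} (hp : 1 < p) (hpq : p < q)
    (hg : g = q / p - 1) (hn : n = p * q / (q - p)) (hβ : 0 < β) :
    ∫⁻ s in Ioi 0, ENNReal.ofReal ((1 + β * s ^ g) ^ (-n)) =
      ENNReal.ofReal (β ^ (-1 / g) * blissEnergy p q) := by
  have h2 : 0 < q - p := by linarith
  have hp0 : 0 < p := by linarith
  have hgeq : g = (q - p) / p := by rw [hg]; field_simp
  have hg0 : 0 < g := by rw [hgeq]; positivity
  have hdg : (0 + 1) / g = p / (q - p) := by rw [hgeq]; field_simp; ring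
  have hlt : (0 + 1) / g < n := by
    rw [hdg, hn]; exact div_lt_div_of_pos_right (by nlinarith) h2
  have h := lintegral_rpow_mul_one_add_rpow (d := 0) (by norm_num) hg0 hlt hβ
  simp only [Real.rpow_zero, one_mul] at h
  rw [h]
  congr 1
  have hn' : n - (0 + 1) / g = p * (q - 1) / (q - p) := by rw [hdg, hn]; field_simp
  rw [hn', hdg, blissEnergy, show q / (q - p) = p / (q - p) + 1 by field_simp; ring,
    Real.Gamma_add_one (by positivity), hn, show -(0 + 1) / g = -1 / g by ring,
    show 1 / g = p / (q - p) by rw [hgeq]; field_simp]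
  ring

/-- The functional equation of `Γ` reduces this to the energy. For `β = 1` the mass is `P / q` times
the energy, so over the whole half-line the extremal function attains the constant of
`bliss_of_mass_lt`. -/
theorem lintegral_mass {p q P g n β : ℝ} (hp : 1 < p) (hpq : p < q) (hP : P = p / (p - 1))
    (hg : g = q / p - 1) (hn : n = p * q / (q - p)) (hβ : 0 < β) :
    ∫⁻ s in Ioi 0, ENNReal.ofReal (s ^ g * (1 + β * s ^ g) ^ (-n)) =
      ENNReal.ofReal (β ^ (-(g + 1) / g) * (P / q * blissEnergy p q)) := by
  have h1 : 0 < p - 1 := by linarith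
  have h2 : 0 < q - p := by linarith
  have hp0 : 0 < p := by linarith
  have hq0 : 0 < q := by linarith
  have hgeq : g = (q - p) / p := by rw [hg]; field_simp
  have hg0 : 0 < g := by rw [hgeq]; positivity
  have hdg : (g + 1) / g = q / (q - p) := by rw [hgeq]; field_simp; ring
  have hlt : (g + 1) / g < n := by
    rw [hdg, hn]; exact div_lt_div_of_pos_right (by nlinarith) h2
  rw [lintegral_rpow_mul_one_add_rpow (d := g) (by linarith) hg0 hlt hβ]
  congr 1
  have hn' : n - (g + 1) / g = q * (p - 1) / (q - p) := by rw [hdg, hn]; field_simp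
  rw [hn', hdg, blissEnergy, show p * (q - 1) / (q - p) = q * (p - 1) / (q - p) + 1 by
    field_simp; ring, Real.Gamma_add_one (by positivity), hn,
    show 1 / g = p / (q - p) by rw [hgeq]; field_simp, hP]
  field_simp

/-- Bliss's inequality. -/
theorem hardyIneq_blissMeasure {p q P : ℝ} (hp : 1 < p) (hpq : p < q) (hP : P = p.conjExponent) :
    HardyIneq p q (blissMeasure p q) halfLebesgue
      (ENNReal.ofReal ((P / q) ^ (1 / q) * sharpFactor p q)) := by
  have h1 : 0 < p - 1 := by linarith
  have h2 : 0 < q - p := by linarith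
  have hp0 : 0 < p := by linarith
  have hq0 : 0 < q := by linarith
  have hP' : P = p / (p - 1) := hP
  have hPpos : 0 < P := by rw [hP']; positivity
  have hK := blissEnergy_pos hp hpq
  have hmass := lintegral_mass hp hpq hP' rfl rfl one_pos
  simp only [Real.one_rpow, one_mul] at hmass
  have hJ0 : 0 < P / q * blissEnergy p q := by positivity
  have hg0 : 0 < q / p - 1 := by rw [show q / p - 1 = (q - p) / p by field_simp]; positivity
  have hcongr : ∀ t ∈ Ioi (0 : ℝ), blissKernel (q / p - 1) (p * q / (q - p)) t =
      t ^ (q / p - 1) * (1 + t ^ (q / p - 1)) ^ (-(p * q / (q - p))) := fun t ht =>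
    blissKernel_of_pos ht
  have hmass' : ∫⁻ t in Ioi 0, ENNReal.ofReal (blissKernel (q / p - 1) (p * q / (q - p)) t) =
      ENNReal.ofReal (P / q * blissEnergy p q) := by
    rw [← hmass]
    exact setLIntegral_congr_fun measurableSet_Ioi fun t ht => by simp only [hcongr t ht]
  obtain ⟨hint, hval⟩ := integrableOn_of_lintegral_ofReal_eq measurableSet_Ioi
    (continuous_blissKernel (p * q / (q - p)) hg0).measurable
    (fun t ht => (blissKernel_pos ht).le) hJ0.le hmass'
  have := hardyIneq_bliss hp hpq hP rfl rfl rfl hint hJ0 hval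
  have e : ((P / q * blissEnergy p q) ^ (1 - q / p) * (P / q) ^ (q / p)) ^ (1 / q) =
      (P / q) ^ (1 / q) * sharpFactor p q := by
    rw [sharpFactor_eq hp hpq, Real.mul_rpow (by positivity) hK.le, mul_right_comm,
      ← Real.rpow_add (by positivity), show 1 - q / p + q / p = 1 by ring, Real.rpow_one,
      Real.mul_rpow (by positivity) (by positivity), ← Real.rpow_mul hK.le]
    congr 2
    field_simp
    ring
  rwa [e] at this

/-! ### The supremum and the extremal functions -/

theorem hardyConst_le {p q : ℝ} {μ ν : Measure ℝ} {C : ℝ≥0∞} (h : HardyIneq p q μ ν C) :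
    hardyConst p q μ ν ≤ C :=
  iSup₂_le fun f hf => ENNReal.div_le_of_le_mul (h f hf.1)

theorem le_hardyConst {p q : ℝ} {μ ν : Measure ℝ} {f : ℝ → ℝ} (hf : f ∈ HardyAC0)
    (h0 : 0 < eLpNorm (deriv f) (ENNReal.ofReal p) ν)
    (h1 : eLpNorm (deriv f) (ENNReal.ofReal p) ν < ∞) :
    eLpNorm f (ENNReal.ofReal q) μ / eLpNorm (deriv f) (ENNReal.ofReal p) ν ≤ hardyConst p q μ ν :=
  le_iSup₂_of_le (f := fun f (_ : f ∈ {f : ℝ → ℝ | f ∈ HardyAC0 ∧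
      0 < eLpNorm (deriv f) (ENNReal.ofReal p) ν ∧ eLpNorm (deriv f) (ENNReal.ofReal p) ν < ∞}) =>
    eLpNorm f (ENNReal.ofReal q) μ / eLpNorm (deriv f) (ENNReal.ofReal p) ν) f ⟨hf, h0, h1⟩ le_rfl

/-- Functions with a bounded nonnegative derivative on `(0, ∞)` are locally absolutely
continuous. -/
theorem mem_HardyAC0_of_hasDerivAt {f f' : ℝ → ℝ} {K : ℝ} (h0 : f 0 = 0)
    (hc : ContinuousOn f (Ici 0)) (hd : ∀ x, 0 < x → HasDerivAt f (f' x) x)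
    (hpos : ∀ x, 0 < x → 0 ≤ f' x) (hK : ∀ x, 0 < x → f' x ≤ K) : f ∈ HardyAC0 := by
  refine ⟨h0, fun b hb => ?_⟩
  have hK0 : 0 ≤ K := (hpos 1 one_pos).trans (hK 1 one_pos)
  have hdiff : DifferentiableOn ℝ f (interior (Ici 0)) := fun x hx => by
    rw [interior_Ici] at hx
    exact (hd x hx).differentiableAt.differentiableWithinAt
  have hmono : MonotoneOn f (Ici 0) := monotoneOn_of_deriv_nonneg (convex_Ici 0) hc hdiff
    fun x hx => by rw [interior_Ici] at hx; rw [(hd x hx).deriv]; exact hpos x hx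
  have hlip : ∀ x ∈ Ici (0 : ℝ), ∀ y ∈ Ici (0 : ℝ), x ≤ y → f y - f x ≤ K * (y - x) :=
    (convex_Ici 0).image_sub_le_mul_sub_of_deriv_le hc hdiff fun x hx => by
      rw [interior_Ici] at hx; rw [(hd x hx).deriv]; exact hK x hx
  have : LipschitzOnWith K.toNNReal f (uIcc 0 b) := by
    refine LipschitzOnWith.of_dist_le_mul fun x hx y hy => ?_
    rw [uIcc_of_le hb] at hx hy
    rw [Real.coe_toNNReal K hK0, Real.dist_eq, Real.dist_eq]
    rcases le_total x y with hxy | hxy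
    · have h1 := hlip x hx.1 y hy.1 hxy
      have h2 := hmono (mem_Ici.2 hx.1) (mem_Ici.2 hy.1) hxy
      rw [abs_sub_comm, abs_sub_comm x y, abs_of_nonneg (by linarith), abs_of_nonneg (by linarith)]
      exact h1
    · have h1 := hlip y hy.1 x hx.1 hxy
      have h2 := hmono (mem_Ici.2 hy.1) (mem_Ici.2 hx.1) hxy
      rw [abs_of_nonneg (by linarith), abs_of_nonneg (by linarith)]
      exact h1
  exact this.absolutelyContinuousOnInterval

section Optimizers

variable {p q α β : ℝ}

theorem bliss_gamma_pos (hp : 1 < p) (hpq : p < q) : 0 < q / p - 1 := by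
  have h2 : 0 < q - p := by linarith
  have hp0 : 0 < p := by linarith
  rw [show q / p - 1 = (q - p) / p by field_simp]; positivity

theorem hasDerivAt_blissFun (hp : 1 < p) (hpq : p < q) (hβ : 0 < β) {x : ℝ} (hx : 0 < x) :
    HasDerivAt (blissFun p q α β)
      (α / (β * x ^ (q / p - 1) + 1) ^ ((q / p - 1 + 1) / (q / p - 1))) x := by
  have hg := bliss_gamma_pos hp hpq
  set g := q / p - 1 with hgdef
  have hz : 0 < 1 + β * x ^ g := by positivity
  have e1 := ((((hasDerivAt_id x).rpow_const (p := g) (Or.inl hx.ne')).const_mul β).const_add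
    1).rpow_const (p := -(1 / g)) (Or.inl hz.ne')
  have e2 := ((hasDerivAt_id x).const_mul α).mul e1
  have e3 : HasDerivAt (fun y : ℝ => α * y * (1 + β * y ^ g) ^ (-(1 / g)))
      (α / (β * x ^ g + 1) ^ ((g + 1) / g)) x := by
    refine e2.congr_deriv ?_
    simp only [id, one_mul, mul_one]
    rw [add_comm (β * x ^ g) 1, Real.rpow_sub_one hx.ne' g, Real.rpow_sub_one hz.ne' (-(1 / g)),
      show (g + 1) / g = 1 / g + 1 by field_simp; ring, Real.rpow_add_one hz.ne', Real.rpow_neg hz.le]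
    have : 0 < (1 + β * x ^ g) ^ (1 / g) := by positivity
    field_simp
    ring
  refine e3.congr_of_eventuallyEq ?_
  filter_upwards [lt_mem_nhds hx] with y hy
  have hz' : 0 < 1 + β * y ^ g := by have : (0 : ℝ) < y := hy; positivity
  rw [blissFun, Real.rpow_neg hz'.le]; rfl

theorem blissFun_mem_HardyAC0 (hp : 1 < p) (hpq : p < q) (hα : 0 < α) (hβ : 0 < β) :
    blissFun p q α β ∈ HardyAC0 := by
  have hg := bliss_gamma_pos hp hpq
  refine mem_HardyAC0_of_hasDerivAt (K := α) (by simp [blissFun]) ?_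
    (fun x hx => hasDerivAt_blissFun hp hpq hβ hx) (fun x hx => by positivity) fun x hx => ?_
  · have hc : ContinuousOn (fun x : ℝ => 1 + β * x ^ (q / p - 1)) (Ici 0) :=
      (continuous_const.add (continuous_const.mul
        (Real.continuous_rpow_const hg.le))).continuousOn
    have hpos : ∀ x ∈ Ici (0 : ℝ), 0 < 1 + β * x ^ (q / p - 1) := fun x hx => by
      have : (0 : ℝ) ≤ x := hx
      positivity
    refine ContinuousOn.div (by fun_prop) (hc.rpow_const fun x hx => Or.inl (hpos x hx).ne') ?_
    exact fun x hx => (Real.rpow_pos_of_pos (hpos x hx) _).ne'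
  · refine div_le_self hα.le (Real.one_le_rpow ?_ (by positivity))
    have : 0 < β * x ^ (q / p - 1) := by positivity
    linarith

theorem eLpNorm_deriv_blissFun (hp : 1 < p) (hpq : p < q) (hα : 0 < α) (hβ : 0 < β) :
    eLpNorm (deriv (blissFun p q α β)) (ENNReal.ofReal p) halfLebesgue =
      ENNReal.ofReal (α * (β ^ (-1 / (q / p - 1)) * blissEnergy p q) ^ (1 / p)) := by
  have hp0 : 0 < p := by linarith
  have h2 : 0 < q - p := by linarith
  have hg := bliss_gamma_pos hp hpq
  have hK := blissEnergy_pos hp hpq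
  have hE := lintegral_energy hp hpq rfl rfl hβ
  rw [eLpNorm_ofReal_eq hp0]
  have : ∫⁻ x, ENNReal.ofReal (|deriv (blissFun p q α β) x| ^ p) ∂halfLebesgue =
      ENNReal.ofReal (α ^ p) * ENNReal.ofReal (β ^ (-1 / (q / p - 1)) * blissEnergy p q) := by
    rw [← hE, ← lintegral_const_mul _ (by fun_prop), halfLebesgue]
    refine setLIntegral_congr_fun measurableSet_Ioi fun x hx => ?_
    have hx0 : (0 : ℝ) < x := hx
    have hz : 0 < 1 + β * x ^ (q / p - 1) := by positivity
    rw [(hasDerivAt_blissFun hp hpq hβ hx0).deriv, ← ENNReal.ofReal_mul (by positivity),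
      add_comm (β * _) 1, abs_of_pos (by positivity), Real.div_rpow hα.le (by positivity),
      ← Real.rpow_mul hz.le, Real.rpow_neg hz.le, div_eq_mul_inv]
    congr 4
    field_simp
    ring
  rw [this, ← ENNReal.ofReal_mul (by positivity), ENNReal.ofReal_rpow_of_nonneg (by positivity)
    (by positivity), Real.mul_rpow (by positivity) (by positivity), ← Real.rpow_mul hα.le,
    mul_one_div_cancel hp0.ne', Real.rpow_one]

theorem eLpNorm_blissFun {P : ℝ} (hp : 1 < p) (hpq : p < q) (hP : P = p.conjExponent)
    (hα : 0 < α) (hβ : 0 < β) :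
    eLpNorm (blissFun p q α β) (ENNReal.ofReal q) (blissMeasure p q) =
      ENNReal.ofReal (α * (β ^ (-(q / p - 1 + 1) / (q / p - 1)) * (P / q * blissEnergy p q)) ^ (1 / q)) := by
  have hp0 : 0 < p := by linarith
  have hq0 : 0 < q := by linarith
  have h1 : 0 < p - 1 := by linarith
  have h2 : 0 < q - p := by linarith
  have hP' : P = p / (p - 1) := hP
  have hPpos : 0 < P := by rw [hP']; positivity
  have hg := bliss_gamma_pos hp hpq
  have hK := blissEnergy_pos hp hpq
  have hM := lintegral_mass hp hpq hP' rfl rfl hβ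
  have hmeas : Measurable (blissFun p q α β) := by unfold blissFun; fun_prop
  rw [eLpNorm_blissMeasure (m := q / p.conjExponent + 1) rfl hq0 hmeas fun x hx => by
    unfold blissFun; positivity]
  have : ∫⁻ x in Ioi 0, ENNReal.ofReal (blissFun p q α β x ^ q * x ^ (-(q / p.conjExponent + 1))) =
      ENNReal.ofReal (α ^ q) * ENNReal.ofReal (β ^ (-(q / p - 1 + 1) / (q / p - 1)) *
        (P / q * blissEnergy p q)) := by
    rw [← hM, ← lintegral_const_mul _ (by fun_prop)]
    refine setLIntegral_congr_fun measurableSet_Ioi fun x hx => ?_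
    have hx0 : (0 : ℝ) < x := hx
    have hz : 0 < 1 + β * x ^ (q / p - 1) := by positivity
    rw [blissFun, ← ENNReal.ofReal_mul (by positivity), Real.div_rpow (by positivity) (by positivity),
      Real.mul_rpow hα.le hx0.le, ← Real.rpow_mul hz.le, Real.rpow_neg hz.le]
    rw [show 1 / (q / p - 1) * q = p * q / (q - p) by
        rw [show q / p - 1 = (q - p) / p by field_simp]; field_simp,
      show q / p - 1 = q + -(q / p.conjExponent + 1) by
        rw [← hP, hP']; field_simp; ring, Real.rpow_add hx0]
    congr 1
    ring
  rw [this, ← ENNReal.ofReal_mul (by positivity), ENNReal.ofReal_rpow_of_nonneg (by positivity)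
    (by positivity), Real.mul_rpow (by positivity) (by positivity), ← Real.rpow_mul hα.le,
    mul_one_div_cancel hq0.ne', Real.rpow_one]

/-- Mass and energy scale in `β` with exponents `-(g + 1) / g` and `-1 / g`, where `g = q / p - 1`.
As `g + 1 = q / p`, these agree after taking the roots `1 / q` and `1 / p`, so the quotient depends
on neither `α` nor `β`. -/
theorem eLpNorm_blissFun_eq {P : ℝ} (hp : 1 < p) (hpq : p < q) (hP : P = p.conjExponent)
    (hα : 0 < α) (hβ : 0 < β) :
    eLpNorm (blissFun p q α β) (ENNReal.ofReal q) (blissMeasure p q) =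
      ENNReal.ofReal ((P / q) ^ (1 / q) * sharpFactor p q) *
        eLpNorm (deriv (blissFun p q α β)) (ENNReal.ofReal p) halfLebesgue := by
  have hp0 : 0 < p := by linarith
  have hq0 : 0 < q := by linarith
  have h1 : 0 < p - 1 := by linarith
  have h2 : 0 < q - p := by linarith
  have hP' : P = p / (p - 1) := hP
  have hPpos : 0 < P := by rw [hP']; positivity
  have hg := bliss_gamma_pos hp hpq
  have hK := blissEnergy_pos hp hpq
  have hs : 0 < sharpFactor p q := by rw [sharpFactor_eq hp hpq]; positivity
  rw [eLpNorm_blissFun hp hpq hP hα hβ, eLpNorm_deriv_blissFun hp hpq hα hβ,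
    ← ENNReal.ofReal_mul (by positivity), sharpFactor_eq hp hpq]
  congr 1
  rw [Real.mul_rpow (by positivity) (by positivity), Real.mul_rpow (by positivity) hK.le,
    Real.mul_rpow (by positivity) hK.le, ← Real.rpow_mul hβ.le, ← Real.rpow_mul hβ.le,
    show -(q / p - 1 + 1) / (q / p - 1) * (1 / q) = -1 / (q / p - 1) * (1 / p) by field_simp; ring,
    show 1 / q = -(1 / p - 1 / q) + 1 / p by ring, Real.rpow_add hK]
  ring_nf

theorem hardyConst_blissMeasure {P : ℝ} (hp : 1 < p) (hpq : p < q) (hP : P = p.conjExponent) :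
    hardyConst p q (blissMeasure p q) halfLebesgue =
      ENNReal.ofReal ((P / q) ^ (1 / q) * sharpFactor p q) := by
  refine le_antisymm (hardyConst_le (hardyIneq_blissMeasure hp hpq hP)) ?_
  have hK := blissEnergy_pos hp hpq
  have hE := eLpNorm_deriv_blissFun hp hpq one_pos one_pos
  have h0 : 0 < eLpNorm (deriv (blissFun p q 1 1)) (ENNReal.ofReal p) halfLebesgue := by
    rw [hE, ENNReal.ofReal_pos]; positivity
  have h1 : eLpNorm (deriv (blissFun p q 1 1)) (ENNReal.ofReal p) halfLebesgue < ∞ := by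
    rw [hE]; exact ENNReal.ofReal_lt_top
  refine le_trans (le_of_eq ?_) (le_hardyConst (blissFun_mem_HardyAC0 hp hpq one_pos one_pos) h0 h1)
  rw [eLpNorm_blissFun_eq hp hpq hP one_pos one_pos, ENNReal.mul_div_cancel_right h0.ne' h1.ne]

end Optimizers

/-! ### The constant `B` and the upper approximating sequence -/

theorem setLIntegral_hardyHat_mul (p : ℝ) (x : ℝ) (G : ℝ → ℝ≥0∞) :
    ∫⁻ y in Ioo 0 x, hardyHat p halfLebesgue y * G y = ∫⁻ y in Ioo 0 x, G y := by
  refine lintegral_congr_ae ?_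
  have h := Measure.rnDeriv_restrict_self (volume : Measure ℝ) (measurableSet_Ioi (a := (0 : ℝ)))
  filter_upwards [ae_restrict_of_ae h, ae_restrict_mem measurableSet_Ioo] with y hy hy'
  rw [hardyHat, halfLebesgue, hy, indicator_of_mem (mem_Ioi.2 hy'.1)]
  simp

theorem hardyPhi_halfLebesgue (p x : ℝ) : hardyPhi p halfLebesgue x = ENNReal.ofReal x := by
  have := setLIntegral_hardyHat_mul p x (fun _ => 1)
  simp only [mul_one] at this
  rw [hardyPhi, this]
  simp

theorem setLIntegral_Ioi_ofReal_rpow {a y : ℝ} (ha : a < -1) (hy : 0 < y) :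
    ∫⁻ z in Ioi y, ENNReal.ofReal (z ^ a) = ENNReal.ofReal (-y ^ (a + 1) / (a + 1)) := by
  rw [← integral_Ioi_rpow_of_lt ha hy, ofReal_integral_eq_lintegral_ofReal
    (integrableOn_Ioi_rpow_of_lt ha hy)]
  rw [Filter.EventuallyLE, ae_restrict_iff' measurableSet_Ioi]
  exact Filter.Eventually.of_forall fun z hz => Real.rpow_nonneg (hy.trans hz).le _

theorem setLIntegral_Ioo_ofReal_rpow {a x : ℝ} (ha : -1 < a) (hx : 0 < x) :
    ∫⁻ z in Ioo 0 x, ENNReal.ofReal (z ^ a) = ENNReal.ofReal (x ^ (a + 1) / (a + 1)) := by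
  have hi := intervalIntegral.intervalIntegrable_rpow' (a := 0) (b := x) ha
  have hv := integral_rpow (a := 0) (b := x) (Or.inl ha)
  rw [Real.zero_rpow (by linarith), sub_zero, intervalIntegral.integral_of_le hx.le] at hv
  rw [setLIntegral_congr Ioo_ae_eq_Ioc, ← hv, ofReal_integral_eq_lintegral_ofReal
    ((intervalIntegrable_iff_integrableOn_Ioc_of_le hx.le).1 hi)]
  rw [Filter.EventuallyLE, ae_restrict_iff' measurableSet_Ioc]
  exact Filter.Eventually.of_forall fun z hz => Real.rpow_nonneg hz.1.le _

theorem setLIntegral_blissMeasure {p q m y : ℝ} (hm : m = q / p.conjExponent + 1) (hy : 0 ≤ y)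
    {F : ℝ → ℝ≥0∞} (hF : Measurable F) :
    ∫⁻ x in Ioi y, F x ∂blissMeasure p q = ∫⁻ x in Ioi y, ENNReal.ofReal (x ^ (-m)) * F x := by
  rw [← lintegral_indicator measurableSet_Ioi, lintegral_blissMeasure hm
    (hF.indicator measurableSet_Ioi)]
  have : ∀ x, ENNReal.ofReal (x ^ (-m)) * (Ioi y).indicator F x =
      (Ioi y).indicator (fun x => ENNReal.ofReal (x ^ (-m)) * F x) x := fun x => by
    by_cases hx : x ∈ Ioi y <;> simp [hx]
  simp only [this]
  rw [setLIntegral_indicator measurableSet_Ioi, inter_eq_left.2 (Ioi_subset_Ioi hy)]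

section

variable {p q P : ℝ}

theorem hardyB_blissMeasure (hp : 1 < p) (hq : 0 < q) (hP : P = p.conjExponent) :
    hardyB p q (blissMeasure p q) halfLebesgue = ENNReal.ofReal ((P / q) ^ (1 / q)) := by
  have h1 : 0 < p - 1 := by linarith
  have hP' : P = p / (p - 1) := hP
  have hPpos : 0 < P := by rw [hP']; exact div_pos (by linarith) h1
  have hterm : ∀ x ∈ Ioi (0 : ℝ), hardyPhi p halfLebesgue x ^ (1 / p.conjExponent) *
      blissMeasure p q (Ioi x) ^ (1 / q) = ENNReal.ofReal ((P / q) ^ (1 / q)) := by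
    intro x hx
    have hx0 : (0 : ℝ) < x := hx
    have hμ : blissMeasure p q (Ioi x) = ENNReal.ofReal (P / q * x ^ (-(q / P))) := by
      rw [← setLIntegral_one, setLIntegral_blissMeasure rfl hx0.le measurable_const]
      simp only [mul_one]
      have hqP : 0 < q / P := by positivity
      rw [← hP, setLIntegral_Ioi_ofReal_rpow (by linarith) hx0]
      congr 1
      rw [show -(q / P + 1) + 1 = -(q / P) by ring]
      field_simp
    rw [hμ, hardyPhi_halfLebesgue, ← hP, ENNReal.ofReal_rpow_of_pos hx0,
      ENNReal.ofReal_rpow_of_pos (by positivity), ← ENNReal.ofReal_mul (by positivity)]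
    congr 1
    rw [Real.mul_rpow (by positivity) (by positivity), ← Real.rpow_mul hx0.le,
      mul_left_comm, ← Real.rpow_add hx0, show 1 / P + -(q / P) * (1 / q) = 0 by field_simp; ring,
      Real.rpow_zero, mul_one]
  rw [hardyB, biSup_congr hterm]
  exact biSup_const (nonempty_Ioi (a := (0 : ℝ)))

/-- One step of the upper approximating procedure multiplies the first test function by a
constant. -/
theorem upperStep {θ a : ℝ} (hp : 1 < p) (hq : 0 < q) (hP : P = p.conjExponent)
    (hθ : θ = q / (P + q)) (ha : 0 < a) {F : ℝ → ℝ≥0∞}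
    (hF : ∀ x, 0 < x → F x = ENNReal.ofReal (a * x ^ θ)) {x : ℝ} (hx : 0 < x) :
    ∫⁻ y in Ioo 0 x, hardyHat p halfLebesgue y *
      (∫⁻ z in Ioi y, F z ^ (q / p.conjExponent) ∂blissMeasure p q) ^ (p.conjExponent / q) =
    ENNReal.ofReal (a * (θ⁻¹) ^ (1 + P / q) * x ^ θ) := by
  have h1 : 0 < p - 1 := by linarith
  have hP' : P = p / (p - 1) := hP
  have hPpos : 0 < P := by rw [hP']; exact div_pos (by linarith) h1
  have hθ0 : 0 < θ := by rw [hθ]; positivity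
  rw [setLIntegral_hardyHat_mul, ← hP]
  -- The exponent satisfies `(q / P) * (θ - 1) = -θ`. Hence the integrand is a multiple of `z ^ (-θ
  -- - 1)`, and since `θ * (P / q) = 1 - θ` the outer power produces `y ^ (θ - 1)`, whose primitive
  -- is again a multiple of `x ^ θ`.
  have hinner : ∀ y ∈ Ioo 0 x, (∫⁻ z in Ioi y, F z ^ (q / P) ∂blissMeasure p q) ^ (P / q) =
      ENNReal.ofReal (a * (θ⁻¹) ^ (P / q)) * ENNReal.ofReal (y ^ (θ - 1)) := by
    intro y hy
    have hy0 : 0 < y := hy.1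
    have e1 : ∫⁻ z in Ioi y, F z ^ (q / P) ∂blissMeasure p q =
        ∫⁻ z in Ioi y, ENNReal.ofReal ((a * z ^ θ) ^ (q / P)) ∂blissMeasure p q := by
      refine setLIntegral_congr_fun measurableSet_Ioi fun z hz => ?_
      have hz0 : 0 < z := hy0.trans hz
      simp only [hF z hz0]
      rw [ENNReal.ofReal_rpow_of_pos (by positivity)]
    have e2 : ∫⁻ z in Ioi y, ENNReal.ofReal (z ^ (-(q / P + 1))) *
        ENNReal.ofReal ((a * z ^ θ) ^ (q / P)) =
        ENNReal.ofReal (a ^ (q / P)) * ENNReal.ofReal (θ⁻¹ * y ^ (-θ)) := by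
      have : θ⁻¹ * y ^ (-θ) = -y ^ (-θ - 1 + 1) / (-θ - 1 + 1) := by
        rw [show -θ - 1 + 1 = -θ by ring]; field_simp
      rw [this, ← setLIntegral_Ioi_ofReal_rpow (by linarith) hy0,
        ← lintegral_const_mul _ (by fun_prop)]
      refine setLIntegral_congr_fun measurableSet_Ioi fun z hz => ?_
      have hz0 : 0 < z := hy0.trans hz
      rw [← ENNReal.ofReal_mul (by positivity), ← ENNReal.ofReal_mul (by positivity)]
      congr 1
      rw [Real.mul_rpow ha.le (by positivity), ← Real.rpow_mul hz0.le, mul_left_comm,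
        ← Real.rpow_add hz0]
      congr 2
      rw [hθ]; field_simp; ring
    rw [e1, setLIntegral_blissMeasure (m := q / P + 1) (by rw [hP]) hy0.le (by fun_prop), e2,
      ← ENNReal.ofReal_mul (by positivity), ENNReal.ofReal_rpow_of_pos (by positivity),
      ← ENNReal.ofReal_mul (by positivity)]
    congr 1
    rw [Real.mul_rpow (by positivity) (by positivity), Real.mul_rpow (by positivity) (by positivity),
      ← Real.rpow_mul ha.le, ← Real.rpow_mul hy0.le, show q / P * (P / q) = 1 by field_simp,
      Real.rpow_one, mul_assoc]
    congr 3
    rw [hθ]; field_simp; ring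
  rw [setLIntegral_congr_fun measurableSet_Ioo hinner, lintegral_const_mul _ (by fun_prop),
    setLIntegral_Ioo_ofReal_rpow (by linarith) hx, ← ENNReal.ofReal_mul (by positivity)]
  congr 1
  rw [sub_add_cancel, Real.rpow_add (by positivity), Real.rpow_one]
  field_simp

/-- The power `x ^ θ` is an eigenfunction of the step, so consecutive quotients depend on neither
`x` nor the index. -/
theorem upperSeq_blissMeasure {θ : ℝ} (hp : 1 < p) (hq : 0 < q) (hP : P = p.conjExponent)
    (hθ : θ = q / (P + q)) (n : ℕ) : ∀ x, 0 < x →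
    upperSeq p q (blissMeasure p q) halfLebesgue (n + 1) x =
      ENNReal.ofReal (((θ⁻¹) ^ (1 + P / q)) ^ n * x ^ θ) := by
  have h1 : 0 < p - 1 := by linarith
  have hP' : P = p / (p - 1) := hP
  have hPpos : 0 < P := by rw [hP']; exact div_pos (by linarith) h1
  have hθ0 : 0 < θ := by rw [hθ]; positivity
  induction n with
  | zero =>
    intro x hx
    simp only [upperSeq, pow_zero, one_mul, hardyPhi_halfLebesgue, ← hP, ← hθ]
    rw [ENNReal.ofReal_rpow_of_pos hx]
  | succ n ih =>
    intro x hx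
    rw [upperSeq, upperStep hp hq hP hθ (by positivity) ih hx, pow_succ]

theorem upperRatio_blissMeasure (hp : 1 < p) (hq : 0 < q) (hP : P = p.conjExponent) {n : ℕ}
    (hn : 1 ≤ n) : upperRatio p q (blissMeasure p q) halfLebesgue n =
      ENNReal.ofReal ((1 + P / q) ^ (1 / P + 1 / q)) := by
  have h1 : 0 < p - 1 := by linarith
  have hP' : P = p / (p - 1) := hP
  have hPpos : 0 < P := by rw [hP']; exact div_pos (by linarith) h1
  obtain ⟨k, rfl⟩ := Nat.exists_eq_add_of_le' hn
  set θ := q / (P + q) with hθ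
  have hθ0 : 0 < θ := by rw [hθ]; positivity
  have hterm : ∀ x ∈ Ioi (0 : ℝ), upperSeq p q (blissMeasure p q) halfLebesgue (k + 1 + 1) x /
      upperSeq p q (blissMeasure p q) halfLebesgue (k + 1) x =
      ENNReal.ofReal ((θ⁻¹) ^ (1 + P / q)) := by
    intro x hx
    have hx0 : (0 : ℝ) < x := hx
    rw [upperSeq_blissMeasure hp hq hP hθ _ x hx, upperSeq_blissMeasure hp hq hP hθ _ x hx,
      ← ENNReal.ofReal_div_of_pos (by positivity)]
    congr 1
    rw [pow_succ]
    field_simp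
  rw [upperRatio, biSup_congr hterm, biSup_const (nonempty_Ioi (a := (0 : ℝ))), ← hP,
    ENNReal.ofReal_rpow_of_pos (by positivity), ← Real.rpow_mul (by positivity)]
  congr 1
  rw [show θ⁻¹ = 1 + P / q by rw [hθ]; field_simp; ring]
  congr 1
  field_simp

theorem upperDelta_blissMeasure (hp : 1 < p) (hq : 0 < q) (hP : P = p.conjExponent) {n : ℕ}
    (hn : 1 ≤ n) : upperDelta p q (blissMeasure p q) halfLebesgue n =
      ENNReal.ofReal ((1 + P / q) ^ (1 / P + 1 / q)) := by
  rw [upperDelta, if_pos (Or.inr ?_), upperRatio_blissMeasure hp hq hP hn]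
  rw [upperRatio_blissMeasure hp hq hP le_rfl]
  exact ENNReal.ofReal_lt_top

end

/-! ### The lower bound from truncated linear functions -/

section

variable {p q P : ℝ}

theorem lowerTest_halfLebesgue (p : ℝ) (x₀ : ℝ≥0∞) (x : ℝ) :
    lowerTest p halfLebesgue x₀ x = (min (ENNReal.ofReal x) x₀).toReal := by
  have h : min (ENNReal.ofReal x) x₀ ≠ ∞ := ne_top_of_le_ne_top ENNReal.ofReal_ne_top (min_le_left _ _)
  rw [lowerTest, hardyPhi_halfLebesgue, ENNReal.ofReal_toReal h]

theorem lowerTest_top {x : ℝ} (hx : 0 < x) : lowerTest p halfLebesgue ∞ x = x := by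
  rw [lowerTest_halfLebesgue, min_eq_left le_top, ENNReal.toReal_ofReal hx.le]

theorem lowerTest_ofReal {a x : ℝ} (ha : 0 < a) (hx : 0 < x) :
    lowerTest p halfLebesgue (ENNReal.ofReal a) x = min x a := by
  rw [lowerTest_halfLebesgue, ← ENNReal.ofReal_min, ENNReal.toReal_ofReal (le_min hx.le ha.le)]

theorem eLpNorm_deriv_lowerTest_top (hp : 1 < p) :
    eLpNorm (deriv (lowerTest p halfLebesgue ∞)) (ENNReal.ofReal p) halfLebesgue = ∞ := by
  have hp0 : 0 < p := by linarith
  have : ∫⁻ x, ENNReal.ofReal (|deriv (lowerTest p halfLebesgue ∞) x| ^ p) ∂halfLebesgue =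
      ∫⁻ _, 1 ∂halfLebesgue := by
    refine lintegral_congr_ae ?_
    filter_upwards [ae_halfLebesgue_pos] with x hx
    have hd : HasDerivAt (lowerTest p halfLebesgue ∞) 1 x := by
      refine (hasDerivAt_id x).congr_of_eventuallyEq ?_
      filter_upwards [lt_mem_nhds hx] with y hy using lowerTest_top hy
    simp [hd.deriv]
  rw [eLpNorm_ofReal_eq hp0, this, halfLebesgue, setLIntegral_one, Real.volume_Ioi,
    ENNReal.top_rpow_of_pos (by positivity)]

theorem eLpNorm_deriv_lowerTest {a : ℝ} (hp : 1 < p) (ha : 0 < a) :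
    eLpNorm (deriv (lowerTest p halfLebesgue (ENNReal.ofReal a))) (ENNReal.ofReal p) halfLebesgue =
      ENNReal.ofReal (a ^ (1 / p)) := by
  have hp0 : 0 < p := by linarith
  rw [eLpNorm_ofReal_eq hp0]
  set f := lowerTest p halfLebesgue (ENNReal.ofReal a) with hf
  have : ∫⁻ x, ENNReal.ofReal (|deriv f x| ^ p) ∂halfLebesgue =
      ∫⁻ x in Ioi (0 : ℝ), (Iio a).indicator 1 x := by
    rw [halfLebesgue]
    refine lintegral_congr_ae ?_
    have hne : ∀ᵐ x : ℝ ∂(volume.restrict (Ioi 0)), x ≠ a :=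
      ae_restrict_of_ae (Measure.ae_ne volume a)
    filter_upwards [ae_restrict_mem measurableSet_Ioi, hne] with x hx hxa
    have hx0 : (0 : ℝ) < x := hx
    rcases lt_or_gt_of_ne hxa with h | h
    · have hd : HasDerivAt f 1 x := by
        refine (hasDerivAt_id x).congr_of_eventuallyEq ?_
        filter_upwards [lt_mem_nhds hx0, gt_mem_nhds h] with y hy hya
        rw [hf, lowerTest_ofReal ha hy, min_eq_left hya.le]; rfl
      rw [hd.deriv, indicator_of_mem (mem_Iio.2 h)]; simp
    · have hd : HasDerivAt f 0 x := by
        refine (hasDerivAt_const x a).congr_of_eventuallyEq ?_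
        filter_upwards [lt_mem_nhds hx0, lt_mem_nhds h] with y hy hya
        rw [hf, lowerTest_ofReal ha hy, min_eq_right hya.le]
      rw [hd.deriv, indicator_of_notMem (by simpa using h.le)]; simp [hp0.ne']
  rw [this, setLIntegral_indicator measurableSet_Iio, Iio_inter_Ioi]
  simp only [Pi.one_apply, setLIntegral_one, Real.volume_Ioo, sub_zero]
  rw [ENNReal.ofReal_rpow_of_pos ha]

theorem eLpNorm_lowerTest {a : ℝ} (hp : 1 < p) (hpq : p < q) (hP : P = p.conjExponent)
    (ha : 0 < a) :
    eLpNorm (lowerTest p halfLebesgue (ENNReal.ofReal a)) (ENNReal.ofReal q) (blissMeasure p q) =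
      ENNReal.ofReal ((p * P / q) ^ (1 / q) * a ^ (1 / p)) := by
  have hp0 : 0 < p := by linarith
  have hq0 : 0 < q := by linarith
  have h1 : 0 < p - 1 := by linarith
  have hP' : P = p / (p - 1) := hP
  have hPpos : 0 < P := by rw [hP']; positivity
  have hmeas : Measurable (lowerTest p halfLebesgue (ENNReal.ofReal a)) := by
    have : lowerTest p halfLebesgue (ENNReal.ofReal a) =
        fun x => (min (ENNReal.ofReal x) (ENNReal.ofReal a)).toReal :=
      funext fun x => lowerTest_halfLebesgue p _ x
    rw [this]; fun_prop
  rw [eLpNorm_blissMeasure (m := q / P + 1) (by rw [hP]) hq0 hmeas fun x hx => by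
    rw [lowerTest_ofReal ha hx]; exact le_min hx.le ha.le]
  have hsplit : Ioi (0 : ℝ) = Ioc 0 a ∪ Ioi a := (Ioc_union_Ioi_eq_Ioi ha.le).symm
  have hqp : q + -(q / P + 1) = q / p - 1 := by rw [hP']; field_simp; ring
  have e1 : ∫⁻ x in Ioc 0 a, ENNReal.ofReal
      (lowerTest p halfLebesgue (ENNReal.ofReal a) x ^ q * x ^ (-(q / P + 1))) =
      ENNReal.ofReal (a ^ (q / p) * (p / q)) := by
    have : a ^ (q / p) * (p / q) = a ^ (q / p - 1 + 1) / (q / p - 1 + 1) := by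
      rw [sub_add_cancel]; field_simp
    have hqp0 : 0 < q / p := by positivity
    rw [this, ← setLIntegral_Ioo_ofReal_rpow (by linarith) ha, ← setLIntegral_congr Ioo_ae_eq_Ioc]
    refine setLIntegral_congr_fun measurableSet_Ioo fun x hx => ?_
    rw [lowerTest_ofReal ha hx.1, min_eq_left hx.2.le, ← Real.rpow_add hx.1, hqp]
  have e2 : ∫⁻ x in Ioi a, ENNReal.ofReal
      (lowerTest p halfLebesgue (ENNReal.ofReal a) x ^ q * x ^ (-(q / P + 1))) =
      ENNReal.ofReal (a ^ (q / p) * (P / q)) := by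
    have hqP : 0 < q / P := by positivity
    have : a ^ (q / p) * (P / q) = a ^ q * (-a ^ (-(q / P + 1) + 1) / (-(q / P + 1) + 1)) := by
      rw [show q / p = q + -(q / P) by linarith, Real.rpow_add ha,
        show -(q / P + 1) + 1 = -(q / P) by ring]
      field_simp
    rw [this, ENNReal.ofReal_mul (by positivity), ← setLIntegral_Ioi_ofReal_rpow (by linarith) ha,
      ← lintegral_const_mul _ (by fun_prop)]
    refine setLIntegral_congr_fun measurableSet_Ioi fun x hx => ?_
    have hx0 : 0 < x := ha.trans hx
    have hxa : a ≤ x := le_of_lt hx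
    rw [lowerTest_ofReal ha hx0, min_eq_right hxa, ENNReal.ofReal_mul (by positivity)]
  rw [hsplit, lintegral_union measurableSet_Ioi (Ioc_disjoint_Ioi le_rfl), e1, e2,
    ← ENNReal.ofReal_add (by positivity) (by positivity), ENNReal.ofReal_rpow_of_pos (by positivity)]
  congr 1
  rw [show a ^ (q / p) * (p / q) + a ^ (q / p) * (P / q) = p * P / q * a ^ (q / p) by
    have : p + P = p * P := by rw [hP']; field_simp; ring
    rw [← this]; ring]
  rw [Real.mul_rpow (by positivity) (by positivity), ← Real.rpow_mul ha.le]
  congr 2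
  field_simp

theorem lowerDelta1_blissMeasure (hp : 1 < p) (hpq : p < q) (hP : P = p.conjExponent) :
    lowerDelta1 p q (blissMeasure p q) halfLebesgue = ENNReal.ofReal ((p * P / q) ^ (1 / q)) := by
  have hp0 : 0 < p := by linarith
  have hval : ∀ a : ℝ, 0 < a →
      eLpNorm (lowerTest p halfLebesgue (ENNReal.ofReal a)) (ENNReal.ofReal q) (blissMeasure p q) /
      eLpNorm (deriv (lowerTest p halfLebesgue (ENNReal.ofReal a))) (ENNReal.ofReal p) halfLebesgue =
      ENNReal.ofReal ((p * P / q) ^ (1 / q)) := fun a ha => by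
    have : 0 < a ^ (1 / p) := by positivity
    rw [eLpNorm_lowerTest hp hpq hP ha, eLpNorm_deriv_lowerTest hp ha,
      ← ENNReal.ofReal_div_of_pos this, mul_div_cancel_right₀ _ this.ne']
  refine le_antisymm (iSup₂_le fun x₀ hx₀ => ?_) ?_
  · by_cases htop : x₀ = ∞
    -- Division by `∞` gives `0` in `ℝ≥0∞`, so the untruncated function drops out of the supremum.
    · rw [htop, eLpNorm_deriv_lowerTest_top hp, ENNReal.div_top]; exact zero_le
    · rw [← ENNReal.ofReal_toReal htop]
      exact (hval _ (ENNReal.toReal_pos (ne_of_gt hx₀) htop)).le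
  · refine le_iSup₂_of_le (ENNReal.ofReal 1) (by simp) ?_
    exact (hval 1 one_pos).ge

end

/-! ### The optimal constant for equal exponents -/

/-- Sharpness of the constant in Hardy's inequality. -/
theorem le_hardyConst_hardy {p q m c : ℝ} (hm : m = q / p.conjExponent + 1) (hm1 : 1 < m)
    (hc : 1 - 1 / m < c) :
    ENNReal.ofReal (1 / c) ≤ hardyConst m m (blissMeasure p q) halfLebesgue := by
  have hm0 : 0 < m := by linarith
  have hm2 : 1 / m < 1 := by rw [div_lt_one hm0]; exact hm1
  have hc0 : 0 < c := by linarith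
  have hmc : 0 < (c - 1) * m + 1 := by
    have : (1 - 1 / m) * m < c * m := by gcongr
    rw [sub_mul, one_div_mul_cancel hm0.ne'] at this
    linarith
  -- The primitive is `x ^ c` on `(0, 1)` and constant beyond `1`. The condition on `c` is exactly
  -- integrability of `h ^ m` at `0`. The part of the mass over `(0, 1)` already equals the energy
  -- divided by `c ^ m`.
  set h : ℝ → ℝ := (Ioc 0 1).indicator fun t => c * t ^ (c - 1) with hh
  have hi : IntervalIntegrable (fun t : ℝ => c * t ^ (c - 1)) volume 0 1 :=
    (intervalIntegral.intervalIntegrable_rpow' (by linarith)).const_mul c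
  have hint : Integrable h := by
    rw [hh, integrable_indicator_iff measurableSet_Ioc]
    exact (intervalIntegrable_iff_integrableOn_Ioc_of_le zero_le_one).1 hi
  set f : ℝ → ℝ := fun x => ∫ t in (0 : ℝ)..x, h t with hf
  have hfAC : f ∈ HardyAC0 := by
    refine ⟨by simp [hf], fun b hb => ?_⟩
    exact hint.intervalIntegrable.absolutelyContinuousOnInterval_intervalIntegral (by simp)
  have hder : ∀ᵐ x, deriv f x = h x := by
    filter_upwards [LocallyIntegrable.ae_hasDerivAt_integral hint.locallyIntegrable] with x hx using (hx 0).deriv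
  have hh0 : ∀ x, 0 ≤ h x := fun x => indicator_nonneg (fun t ht => by
    have := ht.1; positivity) x
  have hE : eLpNorm (deriv f) (ENNReal.ofReal m) halfLebesgue =
      ENNReal.ofReal (c * (1 / ((c - 1) * m + 1)) ^ (1 / m)) := by
    rw [eLpNorm_ofReal_eq hm0]
    have : ∫⁻ x, ENNReal.ofReal (|deriv f x| ^ m) ∂halfLebesgue =
        ∫⁻ x in Ioi 0, (Ioc (0 : ℝ) 1).indicator (fun x => ENNReal.ofReal (c ^ m * x ^ ((c - 1) * m))) x := by
      rw [halfLebesgue]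
      refine lintegral_congr_ae ?_
      filter_upwards [ae_restrict_of_ae hder] with x hx
      rw [hx, abs_of_nonneg (hh0 x)]
      by_cases hx1 : x ∈ Ioc (0 : ℝ) 1
      · have hx0 : 0 < x := hx1.1
        rw [hh, indicator_of_mem hx1, indicator_of_mem hx1, Real.mul_rpow hc0.le (by positivity),
          ← Real.rpow_mul hx0.le]
      · rw [hh, indicator_of_notMem hx1, indicator_of_notMem hx1, Real.zero_rpow hm0.ne']; simp
    rw [this, setLIntegral_indicator measurableSet_Ioc, inter_eq_left.2 (fun x hx => hx.1),
      ← setLIntegral_congr Ioo_ae_eq_Ioc]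
    simp_rw [ENNReal.ofReal_mul (show 0 ≤ c ^ m by positivity)]
    rw [lintegral_const_mul _ (by fun_prop), setLIntegral_Ioo_ofReal_rpow (by linarith) one_pos,
      ← ENNReal.ofReal_mul (by positivity), ENNReal.ofReal_rpow_of_nonneg (by positivity) (by positivity),
      Real.one_rpow, Real.mul_rpow (by positivity) (by positivity), ← Real.rpow_mul hc0.le,
      mul_one_div_cancel hm0.ne', Real.rpow_one]
  have hE0 : 0 < eLpNorm (deriv f) (ENNReal.ofReal m) halfLebesgue := by
    rw [hE, ENNReal.ofReal_pos]; positivity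
  have hE1 : eLpNorm (deriv f) (ENNReal.ofReal m) halfLebesgue < ∞ := by
    rw [hE]; exact ENNReal.ofReal_lt_top
  have hfval : ∀ x ∈ Ioo (0 : ℝ) 1, f x = x ^ c := by
    intro x hx
    have : f x = ∫ t in (0 : ℝ)..x, c * t ^ (c - 1) := by
      rw [hf]
      simp only [intervalIntegral.integral_of_le hx.1.le]
      refine setIntegral_congr_fun measurableSet_Ioc fun t ht => ?_
      rw [hh, indicator_of_mem (show t ∈ Ioc (0 : ℝ) 1 from ⟨ht.1, ht.2.trans hx.2.le⟩)]
    rw [this, intervalIntegral.integral_const_mul, integral_rpow (Or.inl (by linarith)),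
      sub_add_cancel, Real.zero_rpow hc0.ne']
    field_simp
    ring
  have hfm : Measurable f := (intervalIntegral.continuous_primitive
    (fun a b => hint.intervalIntegrable) 0).measurable
  have hM : ENNReal.ofReal ((1 / ((c - 1) * m + 1)) ^ (1 / m)) ≤
      eLpNorm f (ENNReal.ofReal m) (blissMeasure p q) := by
    rw [eLpNorm_blissMeasure hm hm0 hfm fun x hx =>
      intervalIntegral.integral_nonneg hx.le fun t _ => hh0 t]
    rw [← ENNReal.ofReal_rpow_of_nonneg (by positivity) (by positivity)]
    gcongr
    have : ∫⁻ x in Ioo 0 1, ENNReal.ofReal (f x ^ m * x ^ (-m)) =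
        ENNReal.ofReal (1 / ((c - 1) * m + 1)) := by
      have h1 := setLIntegral_Ioo_ofReal_rpow (a := (c - 1) * m) (by linarith) one_pos
      rw [Real.one_rpow] at h1
      rw [← h1]
      refine setLIntegral_congr_fun measurableSet_Ioo fun x hx => ?_
      rw [hfval x hx, ← Real.rpow_mul hx.1.le, ← Real.rpow_add hx.1]
      ring_nf
    rw [← this]
    exact lintegral_mono_set fun x hx => hx.1
  refine le_trans ?_ (le_hardyConst hfAC hE0 hE1)
  refine le_trans (le_of_eq ?_) (ENNReal.div_le_div_right hM _)
  have hA : 0 < (1 / ((c - 1) * m + 1)) ^ (1 / m) := by positivity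
  rw [hE, ← ENNReal.ofReal_div_of_pos (by positivity)]
  congr 1
  field_simp

theorem hardyConst_hardy {p q m : ℝ} (hm : m = q / p.conjExponent + 1) (hm1 : 1 < m) :
    hardyConst m m (blissMeasure p q) halfLebesgue = ENNReal.ofReal (m / (m - 1)) := by
  have hm0 : 0 < m := by linarith
  have hm2 : 0 < 1 - 1 / m := by
    have : 1 / m < 1 := by rw [div_lt_one hm0]; exact hm1
    linarith
  refine le_antisymm (hardyConst_le (hardyIneq_hardy hm hm1)) ?_
  have ht : Filter.Tendsto (fun c : ℝ => ENNReal.ofReal (1 / c)) (nhdsWithin (1 - 1 / m) (Ioi (1 - 1 / m)))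
      (nhds (ENNReal.ofReal (1 / (1 - 1 / m)))) := by
    refine ENNReal.tendsto_ofReal ?_
    have : ContinuousAt (fun c : ℝ => 1 / c) (1 - 1 / m) :=
      continuousAt_const.div continuousAt_id hm2.ne'
    exact this.tendsto.mono_left nhdsWithin_le_nhds
  have e : m / (m - 1) = 1 / (1 - 1 / m) := by
    have : m - 1 ≠ 0 := by linarith
    field_simp
  rw [e]
  refine le_of_tendsto ht ?_
  filter_upwards [self_mem_nhdsWithin] with c hc using le_hardyConst_hardy hm hm1 hc

/-! ### Two-sided estimates for a quotient of Gamma values -/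

theorem lintegral_beta_kernel {u v : ℝ} (hu : 0 < u) (hv : 0 < v) :
    ∫⁻ x in Ioo (0 : ℝ) 1, ENNReal.ofReal (x ^ (u - 1) * (1 - x) ^ (v - 1)) =
      ENNReal.ofReal (Real.Gamma u * Real.Gamma v / Real.Gamma (u + v)) := by
  have hb : 0 < ProbabilityTheory.beta u v := ProbabilityTheory.beta_pos hu hv
  have h := ProbabilityTheory.lintegral_betaPDF_eq_one hu hv
  rw [ProbabilityTheory.lintegral_betaPDF] at h
  have e : ∀ x ∈ Ioo (0 : ℝ) 1, ENNReal.ofReal (x ^ (u - 1) * (1 - x) ^ (v - 1)) =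
      ENNReal.ofReal (ProbabilityTheory.beta u v) *
        ENNReal.ofReal (1 / ProbabilityTheory.beta u v * x ^ (u - 1) * (1 - x) ^ (v - 1)) := by
    intro x _
    rw [← ENNReal.ofReal_mul hb.le]
    congr 1
    field_simp
  rw [setLIntegral_congr_fun measurableSet_Ioo e, lintegral_const_mul _ (by fun_prop), h, mul_one]
  rfl

/-- The lower half of the comparison of the Beta integral with its integrand. -/
theorem lt_integral_beta_left {s t x₀ : ℝ} (hs : 0 < s) (ht : 0 < t) (h0 : 0 < x₀) (h1 : x₀ < 1) :
    x₀ ^ s * (1 - x₀) ^ t * (x₀ / (s + t + 1)) < ∫ x in (0 : ℝ)..x₀, x ^ s * (1 - x) ^ t := by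
  have hy : 0 < 1 - x₀ := by linarith
  -- For `x < x₀` the factor `1 - x` exceeds `(x / x₀) * (1 - x₀)`; this minorant turns the
  -- integrand into a pure power.
  have e : ∫ x in (0 : ℝ)..x₀, x ^ (s + t) * (x₀ ^ (-t) * (1 - x₀) ^ t) =
      x₀ ^ s * (1 - x₀) ^ t * (x₀ / (s + t + 1)) := by
    rw [intervalIntegral.integral_mul_const, integral_rpow (Or.inl (by linarith)),
      Real.zero_rpow (by linarith), sub_zero, Real.rpow_add_one h0.ne', Real.rpow_add h0,
      Real.rpow_neg h0.le]
    have : 0 < x₀ ^ t := by positivity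
    field_simp
  rw [← e]
  have hle : ∀ x ∈ Ioc 0 x₀, x ^ (s + t) * (x₀ ^ (-t) * (1 - x₀) ^ t) =
      x ^ s * (x / x₀ * (1 - x₀)) ^ t := by
    intro x hx
    have hx0 : 0 < x := hx.1
    rw [Real.mul_rpow (by positivity) hy.le, Real.div_rpow hx0.le h0.le, Real.rpow_add hx0,
      Real.rpow_neg h0.le]
    ring
  refine intervalIntegral.integral_lt_integral_of_continuousOn_of_le_of_exists_lt h0 ?_ ?_ ?_
    ⟨x₀ / 2, ⟨by linarith, by linarith⟩, ?_⟩
  · exact ((Real.continuous_rpow_const (by linarith)).mul continuous_const).continuousOn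
  · exact ((Real.continuous_rpow_const hs.le).mul
      ((continuous_const.sub continuous_id).rpow_const fun _ => Or.inr ht.le)).continuousOn
  · intro x hx
    have hx0 : 0 < x := hx.1
    rw [hle x hx]
    gcongr
    rw [div_mul_eq_mul_div, div_le_iff₀ h0]
    nlinarith [hx.2]
  · rw [hle _ ⟨by linarith, by linarith⟩]
    gcongr
    rw [div_mul_eq_mul_div, div_lt_iff₀ h0]
    nlinarith

/-- The reflection `x ↦ 1 - x` reduces the part right of `x₀` to the left estimate with `s` and `t`
exchanged; the weights `x₀` and `1 - x₀` of the two parts add up to `1`. -/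
theorem lt_integral_beta {s t x₀ : ℝ} (hs : 0 < s) (ht : 0 < t) (h0 : 0 < x₀) (h1 : x₀ < 1) :
    x₀ ^ s * (1 - x₀) ^ t / (s + t + 1) < ∫ x in (0 : ℝ)..1, x ^ s * (1 - x) ^ t := by
  have hc : Continuous fun x : ℝ => x ^ s * (1 - x) ^ t :=
    (Real.continuous_rpow_const hs.le).mul
      ((continuous_const.sub continuous_id).rpow_const fun _ => Or.inr ht.le)
  have A := lt_integral_beta_left hs ht h0 h1
  have B := lt_integral_beta_left ht hs (show 0 < 1 - x₀ by linarith) (by linarith)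
  have e : ∫ x in x₀..1, x ^ s * (1 - x) ^ t = ∫ x in (0 : ℝ)..(1 - x₀), x ^ t * (1 - x) ^ s := by
    have := intervalIntegral.integral_comp_sub_left (a := x₀) (b := 1)
      (fun x : ℝ => x ^ t * (1 - x) ^ s) 1
    rw [sub_self] at this
    rw [← this]
    refine intervalIntegral.integral_congr fun x _ => ?_
    simp only [sub_sub_cancel]
    ring
  rw [← intervalIntegral.integral_add_adjacent_intervals (hc.intervalIntegrable 0 x₀)
    (hc.intervalIntegrable x₀ 1), e]
  rw [sub_sub_cancel] at B
  have : x₀ ^ s * (1 - x₀) ^ t / (s + t + 1) = x₀ ^ s * (1 - x₀) ^ t * (x₀ / (s + t + 1)) +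
      (1 - x₀) ^ t * x₀ ^ s * ((1 - x₀) / (t + s + 1)) := by
    rw [add_comm t s]; ring
  rw [this]
  exact add_lt_add A B

theorem lt_Gamma_quotient {s t x₀ : ℝ} (hs : 0 < s) (ht : 0 < t) (h0 : 0 < x₀) (h1 : x₀ < 1) :
    x₀ ^ s * (1 - x₀) ^ t <
      Real.Gamma (s + 1) * Real.Gamma (t + 1) / Real.Gamma (s + t + 1) := by
  have hΓ := Real.Gamma_pos_of_pos (show 0 < s + t + 1 by linarith)
  have hΓ1 := Real.Gamma_pos_of_pos (show 0 < s + 1 by linarith)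
  have hΓ2 := Real.Gamma_pos_of_pos (show 0 < t + 1 by linarith)
  have hb := lintegral_beta_kernel (show 0 < s + 1 by linarith) (show 0 < t + 1 by linarith)
  simp only [add_sub_cancel_right] at hb
  rw [show s + 1 + (t + 1) = s + t + 1 + 1 by ring,
    Real.Gamma_add_one (s := s + t + 1) (by linarith)] at hb
  have hv := (integrableOn_of_lintegral_ofReal_eq measurableSet_Ioo (by fun_prop)
    (fun x hx => mul_nonneg (Real.rpow_nonneg hx.1.le _)
      (Real.rpow_nonneg (by linarith [hx.2]) _)) (by positivity) hb).2
  have := lt_integral_beta hs ht h0 h1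
  rw [intervalIntegral.integral_of_le zero_le_one, integral_Ioc_eq_integral_Ioo, hv,
    div_lt_iff₀ (by linarith)] at this
  refine this.trans_eq ?_
  have : s + t + 1 ≠ 0 := by linarith
  field_simp

/-- The quotient of the two sides is `w ^ (s * (1 - c)) * R ^ (s - 1)` with `R = (1 - w ^ c) / (c *
(1 - w))`. Bernoulli's inequality at `w` and at `w⁻¹` gives `1 ≤ R ≤ w ^ (c - 1)`; the upper bound
serves `s ≥ 1`, the lower one `s < 1`. -/
theorem rpow_substitution_lt {s t c w : ℝ} (hs : 0 < s) (hc0 : 0 < c) (hc1 : c < 1)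
    (hc : c * (s + t + 1) = s + 1) (hw0 : 0 < w) (hw1 : w < 1) :
    c * w ^ (c - 1) * ((w ^ c) ^ t * (1 - w ^ c) ^ (s - 1)) < c ^ s * (1 - w) ^ (s - 1) := by
  have h1w : 0 < 1 - w := by linarith
  have hlow : c * (1 - w) ≤ 1 - w ^ c := by
    have := rpow_one_add_le_one_add_mul_self (s := w - 1) (by linarith) hc0.le hc1.le
    rw [add_sub_cancel] at this
    linarith
  have hup : 1 - w ^ c ≤ c * (1 - w) * w ^ (c - 1) := by
    have := rpow_one_add_le_one_add_mul_self (s := w⁻¹ - 1) (by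
      have : 0 < w⁻¹ := by positivity
      linarith) hc0.le hc1.le
    rw [add_sub_cancel, Real.inv_rpow hw0.le] at this
    have hwc : 0 < w ^ c := by positivity
    rw [Real.rpow_sub_one hw0.ne']
    have h2 := mul_le_mul_of_nonneg_left this hwc.le
    rw [mul_inv_cancel₀ hwc.ne'] at h2
    have : w ^ c * (1 + c * (w⁻¹ - 1)) = w ^ c + c * (1 - w) * (w ^ c / w) := by
      field_simp
    linarith
  have hpos : 0 < 1 - w ^ c := lt_of_lt_of_le (by positivity) hlow
  set R := (1 - w ^ c) / (c * (1 - w)) with hR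
  have hR1 : 1 ≤ R := by rw [hR, one_le_div (by positivity)]; exact hlow
  have hR2 : R ≤ w ^ (c - 1) := by
    rw [hR, div_le_iff₀ (by positivity)]; linarith
  have hRe : 1 - w ^ c = R * (c * (1 - w)) := by rw [hR]; field_simp
  have hfac : w ^ (s * (1 - c)) * R ^ (s - 1) < 1 := by
    rcases le_or_gt 1 s with h | h
    · calc w ^ (s * (1 - c)) * R ^ (s - 1) ≤ w ^ (s * (1 - c)) * (w ^ (c - 1)) ^ (s - 1) := by
            gcongr
        _ = w ^ (1 - c) := by
            rw [← Real.rpow_mul hw0.le, ← Real.rpow_add hw0]; congr 1; ring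
        _ < 1 := Real.rpow_lt_one hw0.le hw1 (by linarith)
    · calc w ^ (s * (1 - c)) * R ^ (s - 1) ≤ w ^ (s * (1 - c)) * 1 := by
            gcongr
            exact Real.rpow_le_one_of_one_le_of_nonpos hR1 (by linarith)
        _ < 1 := by
            rw [mul_one]
            exact Real.rpow_lt_one hw0.le hw1 (mul_pos hs (by linarith))
  have hmain : c * w ^ (c - 1) * ((w ^ c) ^ t * (1 - w ^ c) ^ (s - 1)) =
      w ^ (s * (1 - c)) * R ^ (s - 1) * (c ^ s * (1 - w) ^ (s - 1)) := by
    rw [hRe, Real.mul_rpow (by positivity) (by positivity), Real.mul_rpow hc0.le h1w.le,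
      ← Real.rpow_mul hw0.le, show s * (1 - c) = c - 1 + c * t by linarith, Real.rpow_add hw0,
      Real.rpow_sub_one hc0.ne']
    field_simp
  rw [hmain]
  exact mul_lt_of_lt_one_left (by positivity) hfac

/-- The left side is `s` times the Beta integral of `x ^ t * (1 - x) ^ (s - 1)`. Substituting `x = w
^ c`, with `c` the base on the right, puts the integrand strictly below `c ^ s * (1 - w) ^ (s - 1)`,
whose integral is `c ^ s / s`. -/
theorem Gamma_quotient_lt {s t : ℝ} (hs : 0 < s) (ht : 0 < t) :
    Real.Gamma (s + 1) * Real.Gamma (t + 1) / Real.Gamma (s + t + 1) <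
      ((s + 1) / (s + t + 1)) ^ s := by
  set c := (s + 1) / (s + t + 1) with hcdef
  have hc0 : 0 < c := by positivity
  have hc1 : c < 1 := by rw [hcdef, div_lt_one (by positivity)]; linarith
  have hc : c * (s + t + 1) = s + 1 := by rw [hcdef]; field_simp
  have hΓs := Real.Gamma_pos_of_pos hs
  have hΓ := Real.Gamma_pos_of_pos (show 0 < s + t + 1 by linarith)
  have hΓ2 := Real.Gamma_pos_of_pos (show 0 < t + 1 by linarith)
  have hb := lintegral_beta_kernel (show 0 < t + 1 by linarith) hs
  simp only [add_sub_cancel_right] at hb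
  have himage : (fun w : ℝ => w ^ c) '' Ioo 0 1 = Ioo 0 1 := by
    ext y
    constructor
    · rintro ⟨w, hw, rfl⟩
      exact ⟨Real.rpow_pos_of_pos hw.1 _, Real.rpow_lt_one hw.1.le hw.2 hc0⟩
    · intro hy
      refine ⟨y ^ (1 / c), ⟨Real.rpow_pos_of_pos hy.1 _,
        Real.rpow_lt_one hy.1.le hy.2 (by positivity)⟩, ?_⟩
      simp only
      rw [← Real.rpow_mul hy.1.le, one_div_mul_cancel hc0.ne', Real.rpow_one]
  have hsub := lintegral_image_eq_lintegral_abs_deriv_mul (measurableSet_Ioo (a := (0 : ℝ)) (b := 1))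
    (f := fun w : ℝ => w ^ c) (f' := fun w => c * w ^ (c - 1))
    (fun w hw => (Real.hasDerivAt_rpow_const (Or.inl hw.1.ne')).hasDerivWithinAt)
    ((Real.rpow_left_injOn hc0.ne').mono fun w hw => hw.1.le)
    (fun z => ENNReal.ofReal (z ^ t * (1 - z) ^ (s - 1)))
  rw [himage, hb] at hsub
  have h1 := lintegral_beta_kernel one_pos hs
  simp only [sub_self, Real.rpow_zero, one_mul, Real.Gamma_one] at h1
  rw [add_comm 1 s, Real.Gamma_add_one hs.ne'] at h1
  have hlt : ∫⁻ w in Ioo (0 : ℝ) 1, ENNReal.ofReal |c * w ^ (c - 1)| *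
      ENNReal.ofReal ((w ^ c) ^ t * (1 - w ^ c) ^ (s - 1)) <
      ∫⁻ w in Ioo (0 : ℝ) 1, ENNReal.ofReal (c ^ s) * ENNReal.ofReal ((1 - w) ^ (s - 1)) := by
    refine lintegral_strict_mono ?_ (by fun_prop) ?_ ?_
    · rw [Ne, Measure.restrict_eq_zero]; simp
    · rw [← hsub]; exact ENNReal.ofReal_ne_top
    · filter_upwards [ae_restrict_mem measurableSet_Ioo] with w hw
      have hw0 : 0 < w := hw.1
      rw [← ENNReal.ofReal_mul (abs_nonneg _), ← ENNReal.ofReal_mul (by positivity),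
        abs_of_pos (by positivity)]
      have h1w : 0 < 1 - w := by linarith [hw.2]
      exact (ENNReal.ofReal_lt_ofReal_iff (by positivity)).2
        (rpow_substitution_lt hs hc0 hc1 hc hw0 hw.2)
  rw [← hsub, lintegral_const_mul _ (by fun_prop), h1, ← ENNReal.ofReal_mul (by positivity),
    ENNReal.ofReal_lt_ofReal_iff (by positivity), show t + 1 + s = s + t + 1 by ring] at hlt
  rw [Real.Gamma_add_one hs.ne']
  have h3 := mul_lt_mul_of_pos_left hlt hs
  calc _ = s * (Real.Gamma (t + 1) * Real.Gamma s / Real.Gamma (s + t + 1)) := by ring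
    _ < _ := h3
    _ = _ := by field_simp

/-! ### Comparison of the factors -/

section

variable {p q P : ℝ}

theorem sharpFactor_pos (hp : 1 < p) (hpq : p < q) : 0 < sharpFactor p q := by
  rw [sharpFactor_eq hp hpq]; exact Real.rpow_pos_of_pos (blissEnergy_pos hp hpq) _

theorem blissEnergy_eq (hpq : p < q) : blissEnergy p q =
    Real.Gamma (p / (q - p) + 1) * Real.Gamma (q * (p - 1) / (q - p) + 1) /
      Real.Gamma (p / (q - p) + q * (p - 1) / (q - p) + 1) := by
  have h2 : 0 < q - p := by linarith
  rw [blissEnergy]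
  congr 3 <;> field_simp <;> ring

/-- The Gamma estimate is used at `x₀ = s / (s + t)`, the maximum point of `x ^ s * (1 - x) ^ t`.
Since `s * (1 / p - 1 / q) = 1 / q` and `t * (1 / p - 1 / q)` is the reciprocal of the conjugate
exponent, the resulting bound is exactly the rough factor. -/
theorem sharpFactor_lt_roughFactor (hp : 1 < p) (hpq : p < q) :
    sharpFactor p q < roughFactor p q := by
  have hp0 : 0 < p := by linarith
  have hq0 : 0 < q := by linarith
  have h1 : 0 < p - 1 := by linarith
  have h2 : 0 < q - p := by linarith
  set s := p / (q - p) with hs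
  set t := q * (p - 1) / (q - p) with ht
  have hs0 : 0 < s := by positivity
  have ht0 : 0 < t := by positivity
  have hx1 : s / (s + t) < 1 := by rw [div_lt_one (by positivity)]; linarith
  have h1x : 1 - s / (s + t) = t / (s + t) := by field_simp; ring
  have h := lt_Gamma_quotient hs0 ht0 (show 0 < s / (s + t) by positivity) hx1
  rw [← blissEnergy_eq hpq, h1x] at h
  have hneg : -(1 / p - 1 / q) < 0 := by
    have : 1 / q < 1 / p := one_div_lt_one_div_of_lt hp0 hpq
    linarith
  have h3 := Real.rpow_lt_rpow_of_neg (by positivity) h hneg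
  rw [← sharpFactor_eq hp hpq] at h3
  refine h3.trans_eq ?_
  have hP : p.conjExponent = p / (p - 1) := rfl
  have e1 : 1 + q / p.conjExponent = (s / (s + t))⁻¹ := by
    rw [hP, hs, ht]; field_simp
  have e2 : 1 + p.conjExponent / q = (t / (s + t))⁻¹ := by
    rw [hP, hs, ht]; field_simp; ring
  have e3 : 1 / q = -(s * -(1 / p - 1 / q)) := by rw [hs]; field_simp
  have e4 : 1 / p.conjExponent = -(t * -(1 / p - 1 / q)) := by rw [hP, ht]; field_simp
  rw [roughFactor, e1, e2, Real.mul_rpow (by positivity) (by positivity),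
    ← Real.rpow_mul (by positivity), ← Real.rpow_mul (by positivity), e4,
    Real.inv_rpow (by positivity), Real.inv_rpow (by positivity),
    ← Real.rpow_neg (by positivity), ← Real.rpow_neg (by positivity), neg_neg]
  congr 2
  linarith [e3]

/-- For these parameters the base `(s + 1) / (s + t + 1)` in `Gamma_quotient_lt` is `p⁻¹`, and the
negative exponent reverses the inequality. -/
theorem rpow_lt_sharpFactor (hp : 1 < p) (hpq : p < q) : p ^ (1 / q) < sharpFactor p q := by
  have hp0 : 0 < p := by linarith
  have hq0 : 0 < q := by linarith
  have h1 : 0 < p - 1 := by linarith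
  have h2 : 0 < q - p := by linarith
  have h := Gamma_quotient_lt (show 0 < p / (q - p) by positivity)
    (show 0 < q * (p - 1) / (q - p) by positivity)
  rw [← blissEnergy_eq hpq, show (p / (q - p) + 1) / (p / (q - p) + q * (p - 1) / (q - p) + 1) = p⁻¹ by
    field_simp; ring] at h
  have hneg : -(1 / p - 1 / q) < 0 := by
    have : 1 / q < 1 / p := one_div_lt_one_div_of_lt hp0 hpq
    linarith
  have h3 := Real.rpow_lt_rpow_of_neg (blissEnergy_pos hp hpq) h hneg
  rw [← sharpFactor_eq hp hpq] at h3
  refine lt_of_eq_of_lt ?_ h3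
  rw [← Real.rpow_mul (by positivity), Real.inv_rpow hp0.le, ← Real.rpow_neg hp0.le]
  congr 1
  field_simp

end

/-! ### The theorem -/

theorem mainTheorem7 (p q : ℝ) (hp : 1 < p) (hpq : p < q) :
    -- the optimal constant: the supremum of the quotients is the least admissible constant
    IsLeast {C : ℝ≥0∞ | HardyIneq p q (blissMeasure p q) halfLebesgue C}
      (hardyConst p q (blissMeasure p q) halfLebesgue) ∧
    hardyConst p q (blissMeasure p q) halfLebesgue =
      ENNReal.ofReal ((p.conjExponent / q) ^ (1 / q) * sharpFactor p q) ∧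
    hardyB p q (blissMeasure p q) halfLebesgue =
      ENNReal.ofReal ((p.conjExponent / q) ^ (1 / q)) ∧
    hardyConst p q (blissMeasure p q) halfLebesgue =
      ENNReal.ofReal (sharpFactor p q) * hardyB p q (blissMeasure p q) halfLebesgue ∧
    -- the optimizers
    (∀ α β : ℝ, 0 < α → 0 < β →
      blissFun p q α β ∈ HardyAC0 ∧
      (∀ x : ℝ, 0 < x → HasDerivAt (blissFun p q α β)
        (α / (β * x ^ (q / p - 1) + 1) ^ ((q / p - 1 + 1) / (q / p - 1))) x) ∧
      0 < eLpNorm (deriv (blissFun p q α β)) (ENNReal.ofReal p) halfLebesgue ∧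
      eLpNorm (deriv (blissFun p q α β)) (ENNReal.ofReal p) halfLebesgue < ∞ ∧
      eLpNorm (blissFun p q α β) (ENNReal.ofReal q) (blissMeasure p q) =
        hardyConst p q (blissMeasure p q) halfLebesgue *
          eLpNorm (deriv (blissFun p q α β)) (ENNReal.ofReal p) halfLebesgue) ∧
    -- the upper bounds
    (∀ n : ℕ, 1 ≤ n →
      upperDelta p q (blissMeasure p q) halfLebesgue n =
        ENNReal.ofReal
          ((1 + p.conjExponent / q) ^ (1 / p.conjExponent + 1 / q)) ∧
      upperDelta p q (blissMeasure p q) halfLebesgue n =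
        ENNReal.ofReal (roughFactor p q) * hardyB p q (blissMeasure p q) halfLebesgue ∧
      ENNReal.ofReal (sharpFactor p q) * hardyB p q (blissMeasure p q) halfLebesgue <
        upperDelta p q (blissMeasure p q) halfLebesgue n ∧
      upperDelta p q (blissMeasure p q) halfLebesgue n =
        hardyConst (q / p.conjExponent + 1) (q / p.conjExponent + 1)
          (blissMeasure p q) halfLebesgue ^ (1 / p.conjExponent + 1 / q)) ∧
    hardyConst (q / p.conjExponent + 1) (q / p.conjExponent + 1)
      (blissMeasure p q) halfLebesgue = ENNReal.ofReal (p.conjExponent / q + 1) ∧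
    -- the lower bound
    lowerDelta1 p q (blissMeasure p q) halfLebesgue =
      ENNReal.ofReal ((p * p.conjExponent / q) ^ (1 / q)) ∧
    lowerDelta1 p q (blissMeasure p q) halfLebesgue =
      ENNReal.ofReal (p ^ (1 / q)) * hardyB p q (blissMeasure p q) halfLebesgue ∧
    hardyB p q (blissMeasure p q) halfLebesgue <
      lowerDelta1 p q (blissMeasure p q) halfLebesgue ∧
    lowerDelta1 p q (blissMeasure p q) halfLebesgue <
      hardyConst p q (blissMeasure p q) halfLebesgue := by
  have hp0 : 0 < p := by linarith
  have hq0 : 0 < q := by linarith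
  have h1 : 0 < p - 1 := by linarith
  obtain ⟨P, hP⟩ : ∃ P, P = p.conjExponent := ⟨_, rfl⟩
  have hP' : P = p / (p - 1) := hP
  have hP0 : 0 < P := by rw [hP']; positivity
  have hA := hardyConst_blissMeasure hp hpq hP
  have hB := hardyB_blissMeasure hp hq0 hP
  have hA' : hardyConst p q (blissMeasure p q) halfLebesgue =
      ENNReal.ofReal (sharpFactor p q) * hardyB p q (blissMeasure p q) halfLebesgue := by
    rw [hA, hB, ← ENNReal.ofReal_mul (sharpFactor_pos hp hpq).le, mul_comm]
  have hδ := fun (n : ℕ) (hn : 1 ≤ n) => upperDelta_blissMeasure hp hq0 hP hn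
  have hPq : 0 < (P / q) ^ (1 / q) := by positivity
  have hsharp := sharpFactor_pos hp hpq
  have hrough : (1 + P / q) ^ (1 / P + 1 / q) = roughFactor p q * (P / q) ^ (1 / q) := by
    rw [roughFactor, ← hP, mul_right_comm, ← Real.mul_rpow (by positivity) (by positivity),
      show (1 + q / P) * (P / q) = 1 + P / q by field_simp; ring, ← Real.rpow_add (by positivity),
      add_comm (1 / P)]
  have hrough0 : 0 < roughFactor p q := hsharp.trans (sharpFactor_lt_roughFactor hp hpq)
  have hH : hardyConst (q / P + 1) (q / P + 1) (blissMeasure p q) halfLebesgue =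
      ENNReal.ofReal (P / q + 1) := by
    have hqP : 0 < q / P := by positivity
    rw [hardyConst_hardy (by rw [hP]) (by linarith)]
    rw [add_sub_cancel_right]
    congr 1
    field_simp
    ring
  have hL := lowerDelta1_blissMeasure hp hpq hP
  have hL' : (p * P / q) ^ (1 / q) = p ^ (1 / q) * (P / q) ^ (1 / q) := by
    rw [mul_div_assoc, Real.mul_rpow hp0.le (by positivity)]
  have hp1 : 1 < p ^ (1 / q) := Real.one_lt_rpow hp (by positivity)
  rw [← hP]
  refine ⟨⟨?_, fun C hC => hardyConst_le hC⟩, hA, hB, hA', fun α β hα hβ => ?_, fun n hn => ?_, hH,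
    hL, ?_, ?_, ?_⟩
  -- Bliss's inequality also covers functions whose derivative has norm `0` or `∞`, which the
  -- supremum leaves out.
  · rw [mem_ofPred_eq, hA]
    exact hardyIneq_blissMeasure hp hpq hP
  · have hE := eLpNorm_deriv_blissFun hp hpq hα hβ
    have hK := blissEnergy_pos hp hpq
    refine ⟨blissFun_mem_HardyAC0 hp hpq hα hβ, fun x hx => hasDerivAt_blissFun hp hpq hβ hx,
      ?_, ?_, ?_⟩
    · rw [hE, ENNReal.ofReal_pos]; positivity
    · rw [hE]; exact ENNReal.ofReal_lt_top
    · rw [hA]; exact eLpNorm_blissFun_eq hp hpq hP hα hβ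
  · rw [hδ n hn]
    refine ⟨rfl, ?_, ?_, ?_⟩
    · rw [hB, ← ENNReal.ofReal_mul hrough0.le, hrough]
    · rw [hB, ← ENNReal.ofReal_mul hsharp.le, hrough,
        ENNReal.ofReal_lt_ofReal_iff (mul_pos hrough0 hPq)]
      exact mul_lt_mul_of_pos_right (sharpFactor_lt_roughFactor hp hpq) hPq
    · rw [hH, ENNReal.ofReal_rpow_of_pos (by positivity), add_comm (P / q)]
  · rw [hL, hB, ← ENNReal.ofReal_mul (by positivity), hL']
  · rw [hL, hB, ENNReal.ofReal_lt_ofReal_iff (by positivity), hL']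
    exact lt_mul_of_one_lt_left hPq hp1
  · rw [hL, hA, ENNReal.ofReal_lt_ofReal_iff (by positivity), hL', mul_comm]
    exact mul_lt_mul_of_pos_left (rpow_lt_sharpFactor hp hpq) hPq
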